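/- Let $K$ be a compact Hausdorff space, $\mu$ a positive (finite) regular Borel measure on $K$, and let $T$ be a symmetric absolute contraction on $L^1(K,\mu)$ (complex-valued functions), i.e. a linear operator on $L^1(K,\mu)$ with $\|Tf\|_1\le\|f\|_1$ and $\|Tf\|_\infty\le\|f\|_\infty$ for all $f$ (where $\|f\|_\infty=\infty$ if $f\notin L^\infty$), and $\int_K Tf\cdot\overline{g}\,d\mu=\int_K f\cdot\overline{Tg}\,d\mu$ for all $f,g\in L^1\cap L^\infty$. The following objects exist: * the linear modulus $|T|:C(K)\to L^1(K,\mu)$, i.e. the linear operator with $|T|f=\sup\{|Tu| : u\in C(K),\ |u|\le f\}$ (supremum in the lattice $L^1(K,\mu)$) for $0\le f\in C(K)$; * a positive regular Borel measure $\mu_{|T|}$ on $K\times K$ with $\int_{K\times K}u(x)v(y)\,d\mu_{|T|}(x,y)=\int_K(|T|u)\,v\,d\mu$ for all $u,v\in C(K)$; * a complex regular Borel measure $\mu_T$ on $K\times K$ with $\int_{K\times K}u(x)v(y)\,d\mu_T(x,y)=\int_K(Tu)\,v\,d\mu$ for all $u,v\in C(K)$; * a unimodular density $\lambda$ of $\mu_T$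 with respect to $\mu_{|T|}$, i.e. a $\mu_{|T|}$-measurable $\lambda:K\times K\to\mathbb C$ with $|\lambda|=1$ $\mu_{|T|}$-almost everywhere and $\mu_T=\lambda\,\mu_{|T|}$. Let $\mathrm Z_2=(\{0,1\},\zeta_2)$ be the probability space with two atoms of mass $\tfrac12$, and for $c\in\mathbb C$ put $E_c=\begin{pmatrix}0&\overline c\\ c&0\end{pmatrix}$. For any objects $|T|,\mu_{|T|},\mu_T,\lambda$ as above, all $1\le p,q\le\infty$ with $\frac1p+\frac1q=1$, and all $f\in L^p(K,\mu)$, $g\in L^q(K,\mu)$, the three integrands over $K$, $K$ and $K\times K$ below are integrable and $$\int_K(\mathrm{Id}-T)f\cdot g\,d\mu=\int_K(1-|T|\mathbf 1)\,f\cdot g\,d\mu+\int_{K\times K}\int_{\mathrm Z_2}\bigl[\mathrm{Id}-E_{\lambda(x,y)}\bigr]\begin{pmatrix}f(x)\\f(y)\end{pmatrix}\cdot\begin{pmatrix}g(x)\\g(y)\end{pmatrix}d\zeta_2\,d\mu_{|T|}(x,y),$$ where the inner integrand is the coordinatewise product (without complex conjugation) of two functions on $\{0,1\}$. -/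

import Mathlib

open MeasureTheory
open scoped ENNReal ComplexConjugate

noncomputable section

/-- The product `K × L` of two topological spaces, with the product topology and its full Borel
σ-algebra. (For non-metrizable spaces this σ-algebra can be strictly larger than the product of the
two Borel σ-algebras, which is Mathlib's default on `K × L`.) -/
def BorelProd (K L : Type*) : Type _ := K × L

namespace BorelProd

variable {K L : Type*} [TopologicalSpace K] [TopologicalSpace L]

instance instTopologicalSpace : TopologicalSpace (BorelProd K L) :=
  inferInstanceAs (TopologicalSpace (K × L))

instance instMeasurableSpace : MeasurableSpace (BorelProd K L) := borel _

instance instBorelSpace : BorelSpace (BorelProd K L) := ⟨rfl⟩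

instance instCompactSpace [CompactSpace K] [CompactSpace L] : CompactSpace (BorelProd K L) :=
  inferInstanceAs (CompactSpace (K × L))

instance instT2Space [T2Space K] [T2Space L] : T2Space (BorelProd K L) :=
  inferInstanceAs (T2Space (K × L))

end BorelProd

section Operators

variable {K : Type*} [MeasurableSpace K] (μ : Measure K)

/-- A linear operator on `L¹(K, μ)` is an absolute contraction (Dunford–Schwartz operator) if it is
contractive for the `L¹`-norm and for the `L^∞`-norm. (The second condition is void for `f ∉ L^∞`,
whose `L^∞`-norm is `∞`.) -/
structure IsAbsoluteContraction (T : Lp ℂ 1 μ →ₗ[ℂ] Lp ℂ 1 μ) : Prop where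
  norm_le : ∀ f : Lp ℂ 1 μ, ‖T f‖ ≤ ‖f‖
  eLpNorm_top_le : ∀ f : Lp ℂ 1 μ, eLpNorm (T f) ∞ μ ≤ eLpNorm f ∞ μ

/-- Symmetry: `∫ Tf · conj g = ∫ f · conj (Tg)` for all `f, g ∈ L¹ ∩ L^∞`. -/
def IsSymmetricOperator (T : Lp ℂ 1 μ →ₗ[ℂ] Lp ℂ 1 μ) : Prop :=
  ∀ f g : Lp ℂ 1 μ, MemLp f ∞ μ → MemLp g ∞ μ →
    ∫ x, T f x * conj (g x) ∂μ = ∫ x, f x * conj (T g x) ∂μ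

/-- The element `|h|` of the real Banach lattice `L¹(K, μ; ℝ)`, for `h ∈ L¹(K, μ)`. -/
def absL1 (h : Lp ℂ 1 μ) : Lp ℝ 1 μ := (Lp.memLp h).norm.toLp (fun x => ‖h x‖)

end Operators

section Representation

variable {K : Type*} [TopologicalSpace K] [CompactSpace K] [MeasurableSpace K] [BorelSpace K]
  (μ : Measure K) [IsFiniteMeasure μ]

/-- The operator `C(K) → L¹(K, μ)` obtained from an operator on `L¹(K, μ)`. -/
def onContinuous (T : Lp ℂ 1 μ →ₗ[ℂ] Lp ℂ 1 μ) : C(K, ℂ) →ₗ[ℂ] Lp ℂ 1 μ :=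
  T ∘ₗ (ContinuousMap.toLp 1 μ ℂ : C(K, ℂ) →L[ℂ] Lp ℂ 1 μ).toLinearMap

/-- `A` is the linear modulus `|S|` of `S : C(K) → L¹(K, μ)`: for `0 ≤ f ∈ C(K)`,
`A f = sup { |S g| : g ∈ C(K), |g| ≤ f }`, the supremum being taken in the lattice `L¹(K, μ; ℝ)`.
As the nonnegative functions span `C(K)`, at most one linear `A` has this property. -/
def IsLinearModulus (S A : C(K, ℂ) →ₗ[ℂ] Lp ℂ 1 μ) : Prop :=
  ∀ f : C(K, ℝ), 0 ≤ f → ∃ h : Lp ℝ 1 μ,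
    IsLUB {k : Lp ℝ 1 μ | ∃ g : C(K, ℂ), (∀ x, ‖g x‖ ≤ f x) ∧ k = absL1 μ (S g)} h ∧
    ∀ᵐ x ∂μ, A (ContinuousMap.mk (fun y => (f y : ℂ)) (by fun_prop)) x = (h x : ℂ)

/-- The complex Borel measure `m` on `K × K` is the measure `μ_S` of `S : C(K) → L¹(K, μ)`: it is
regular and `∫ f(x) g(y) dm(x,y) = ∫ (S f) g dμ` for all `f, g ∈ C(K)`. -/
structure IsComplexRepresentingMeasure (S : C(K, ℂ) →ₗ[ℂ] Lp ℂ 1 μ)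
    (m : ComplexMeasure (BorelProd K K)) : Prop where
  regular : m.variation.Regular
  integral_eq : ∀ f g : C(K, ℂ),
    VectorMeasure.integral m (fun z => f z.1 * g z.2) (ContinuousLinearMap.mul ℝ ℂ) =
      ∫ x, S f x * g x ∂μ

/-- The same for an operator whose measure `ν = μ_S` is positive: `ν` is a regular Borel measure on
`K × K` and `∫ f(x) g(y) dν(x,y) = ∫ (S f) g dμ` for all `f, g ∈ C(K)`. -/
structure IsPositiveRepresentingMeasure (S : C(K, ℂ) →ₗ[ℂ] Lp ℂ 1 μ)
    (ν : Measure (BorelProd K K)) : Prop where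
  regular : ν.Regular
  integral_eq : ∀ f g : C(K, ℂ), ∫ z, f z.1 * g z.2 ∂ν = ∫ x, S f x * g x ∂μ

end Representation

/-- `lam` is a unimodular density of the complex measure `m` with respect to the measure `ν`. -/
structure IsUnimodularDensity {Z : Type*} [MeasurableSpace Z] (ν : Measure Z)
    (m : ComplexMeasure Z) (lam : Z → ℂ) : Prop where
  aestronglyMeasurable : AEStronglyMeasurable lam ν
  norm_eq_one : ∀ᵐ z ∂ν, ‖lam z‖ = 1
  eq_withDensity : m = ν.withDensityᵥ lam

/-- The probability measure `ζ₂` of the space `Z₂` of two atoms of equal mass `1/2`. -/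
def zetaTwo : Measure (Fin 2) := (2⁻¹ : ℝ≥0∞) • Measure.count

/-- The matrix `E_c`, with rows `(0, conj c)` and `(c, 0)`. -/
def matrixE (c : ℂ) : Matrix (Fin 2) (Fin 2) ℂ := !![0, conj c; c, 0]

/-- The `Z₂`-form `∫ (Id - E_c) u · v dζ₂` (bilinear: no conjugate on `v`). -/
def formZ2 (c : ℂ) (u v : Fin 2 → ℂ) : ℂ :=
  ∫ i, ((1 - matrixE c).mulVec u) i * v i ∂zetaTwo

end

/-! Existence. Because `T` contracts the uniform norm and ℂⁿ is separable, for almost every y the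
bound |Σ cᵢ (T aᵢ)(y)| ≤ ‖Σ cᵢ aᵢ‖ holds for all coefficients c at once. Taking cᵢ = bᵢ(y) and
integrating shows that Σ aᵢ ⊗ bᵢ ↦ Σ ∫ (T aᵢ) bᵢ dμ is bounded for the uniform norm of C(K × K),
hence extends to a functional Φ (`exists_clm_tensor`). Riesz–Markov–Kakutani for the modulus of Φ,
with a polar decomposition, gives Φ = λν (`exists_measure_unimodular_of_clm`). The second marginal
of ν is at most μ, so ν represents an operator A; since order bounds of `T` pass to Φ
(`norm_clm_le_of_norm_le`), A is the modulus (`isLinearModulus_of_clm`).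

Formula. Symmetry of `T` means that swapping the coordinates conjugates λν. Uniqueness of the polar
decomposition makes ν swap-invariant with λ(y,x) the conjugate of λ(x,y)
(`symmetric_of_isSymmetricOperator`), so both marginals of ν are (|T|1)μ ≤ μ. Hence L^p(μ) pulls
back to L^p(ν) along either coordinate, and ∫ f(x)g(y)λ dν = ∫ Tf·g dμ extends to conjugate
exponents (`integral_operator_mul`). The Z₂-form is half of f(x)g(x) + f(y)g(y) − λf(x)g(y) −
λ̄f(y)g(x): each diagonal term integrates to ∫ |T|1·fg, which cancels against the potential term,
and each cross term to ∫ Tf·g. -/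

/-! ### Pulling back L^p functions along maps with dominated image measure -/

section Pushforward

variable {X Z : Type*} [MeasurableSpace X] [MeasurableSpace Z] {μ : Measure X} {ν : Measure Z}
  {π : Z → X}

theorem memLp_comp_of_map_le (hπ : Measurable π) (hle : ν.map π ≤ μ) {p : ℝ≥0∞} {v : X → ℂ}
    (hv : MemLp v p μ) : MemLp (fun z => v (π z)) p ν :=
  (hv.mono_measure hle).comp_of_map hπ.aemeasurable

theorem ae_comp_of_map_le (hπ : Measurable π) (hle : ν.map π ≤ μ) {P : X → Prop}
    (h : ∀ᵐ x ∂μ, P x) : ∀ᵐ z ∂ν, P (π z) :=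
  ae_of_ae_map hπ.aemeasurable (ae_mono hle h)

theorem eLpNorm_comp_le_of_map_le (hπ : Measurable π) (hle : ν.map π ≤ μ) {p : ℝ≥0∞} {v : X → ℂ}
    (hv : AEStronglyMeasurable v μ) : eLpNorm (fun z => v (π z)) p ν ≤ eLpNorm v p μ := by
  have := eLpNorm_map_measure (p := p) (hv.mono_measure hle) hπ.aemeasurable
  exact this.symm.le.trans (eLpNorm_mono_measure _ hle)

theorem norm_integral_mul_le_eLpNorm {p q : ℝ≥0∞} [p.HolderConjugate q] {u F : Z → ℂ}
    (hu : MemLp u p ν) (hF : MemLp F q ν) :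
    ∫ z, ‖u z * F z‖ ∂ν ≤ (eLpNorm u p ν).toReal * (eLpNorm F q ν).toReal := by
  have h := eLpNorm_smul_le_mul_eLpNorm (r := 1) hF.1 hu.1 (p := p) (q := q)
  rw [integral_norm_eq_lintegral_enorm (f := fun z => u z * F z) (hu.1.mul hF.1),
    ← ENNReal.toReal_mul]
  refine ENNReal.toReal_mono (ENNReal.mul_ne_top hu.2.ne hF.2.ne) ?_
  rw [eLpNorm_one_eq_lintegral_enorm] at h
  simpa using h

/-- Hölder's inequality gives a Lipschitz bound. This drives the density arguments that extend
identities and inequalities from continuous functions to L^p; `N` is the identity or the modulus. -/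
theorem continuous_integral_comp_mul (hπ : Measurable π) (hle : ν.map π ≤ μ) (p : ℝ≥0∞)
    {q : ℝ≥0∞} [Fact (1 ≤ p)] [p.HolderConjugate q] {N : ℂ → ℂ} (hN : LipschitzWith 1 N)
    (hN0 : N 0 = 0) {F : Z → ℂ} (hF : MemLp F q ν) :
    Continuous fun v : Lp ℂ p μ => ∫ z, N (v (π z)) * F z ∂ν := by
  refine (LipschitzWith.of_dist_le_mul (K := (eLpNorm F q ν).toNNReal) fun v w => ?_).continuous
  have hi : ∀ v : Lp ℂ p μ, Integrable (fun z => N (v (π z)) * F z) ν := fun v =>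
    (hN.comp_memLp hN0 (memLp_comp_of_map_le hπ hle (Lp.memLp v))).integrable_mul hF
  have hd : MemLp (fun z => v (π z) - w (π z)) p ν :=
    memLp_comp_of_map_le hπ hle ((Lp.memLp v).sub (Lp.memLp w))
  rw [dist_eq_norm, dist_eq_norm, ← integral_sub (hi v) (hi w)]
  calc ‖∫ z, N (v (π z)) * F z - N (w (π z)) * F z ∂ν‖
      ≤ ∫ z, ‖N (v (π z)) * F z - N (w (π z)) * F z‖ ∂ν := norm_integral_le_integral_norm _
    _ ≤ ∫ z, ‖(v (π z) - w (π z)) * F z‖ ∂ν := by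
        refine integral_mono ((hi v).sub (hi w)).norm (hd.integrable_mul hF).norm fun z => ?_
        simp only [← sub_mul, norm_mul]
        gcongr
        simpa [dist_eq_norm] using hN.dist_le_mul (v (π z)) (w (π z))
    _ ≤ (eLpNorm (fun z => v (π z) - w (π z)) p ν).toReal * (eLpNorm F q ν).toReal :=
        norm_integral_mul_le_eLpNorm hd hF
    _ ≤ _ := by
        rw [mul_comm, Lp.norm_def]
        refine mul_le_mul le_rfl ?_ (by positivity) (by positivity)
        refine ENNReal.toReal_mono (Lp.eLpNorm_ne_top _) ?_
        rw [eLpNorm_congr_ae (Lp.coeFn_sub v w) (p := p)]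
        exact eLpNorm_comp_le_of_map_le (v := v - w) hπ hle ((Lp.memLp v).sub (Lp.memLp w)).1

end Pushforward

/-! ### Testing against continuous functions -/

section Density

theorem ContinuousMap.memLp_of_isFiniteMeasure {X : Type*} [TopologicalSpace X] [CompactSpace X]
    [MeasurableSpace X] [BorelSpace X] (v : C(X, ℂ)) (p : ℝ≥0∞) (μ : Measure X)
    [IsFiniteMeasure μ] : MemLp v p μ :=
  MemLp.of_bound v.continuous.aestronglyMeasurable ‖v‖ (.of_forall v.norm_coe_le_norm)

/-- A measurable phase of a measurable function. -/
theorem exists_measurable_unimodular_mul {Y : Type*} [MeasurableSpace Y] {F : Y → ℂ}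
    (mF : Measurable F) :
    ∃ u : Y → ℂ, Measurable u ∧ (∀ x, ‖u x‖ = 1) ∧ ∀ x, u x * F x = ‖F x‖ := by
  refine ⟨fun x => if F x = 0 then 1 else conj (F x) / ‖F x‖, ?_, fun x => ?_, fun x => ?_⟩
  · refine Measurable.ite (mF (measurableSet_singleton 0)) measurable_const ?_
    exact (Complex.continuous_conj.measurable.comp mF).div
      (Complex.measurable_ofReal.comp mF.norm)
  · by_cases h0 : F x = 0 <;> simp [h0]
  · by_cases h0 : F x = 0
    · simp [h0]
    · have : (‖F x‖ : ℂ) ≠ 0 := by simpa using h0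
      simp only [if_neg h0]
      rw [div_mul_eq_mul_div, Complex.conj_mul', sq, mul_div_cancel_right₀ _ this]

variable {X : Type*} [TopologicalSpace X] [CompactSpace X] [T2Space X] [MeasurableSpace X]
  [BorelSpace X]

/-- A domination inequality between two integral functionals passes from continuous to
square-integrable test functions. -/
theorem norm_integral_mul_le_of_forall_continuousMap {ρ ν₁ ν₂ : Measure X} [IsFiniteMeasure ρ]
    [ρ.Regular] (h₁ : ν₁ ≤ ρ) (h₂ : ν₂ ≤ ρ) {F : X → ℂ} {G : X → ℝ} (hF : MemLp F 2 ν₁)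
    (hG : MemLp G 2 ν₂)
    (h : ∀ v : C(X, ℂ), ‖∫ x, v x * F x ∂ν₁‖ ≤ ∫ x, ‖v x‖ * G x ∂ν₂)
    {v : X → ℂ} (hv : MemLp v 2 ρ) : ‖∫ x, v x * F x ∂ν₁‖ ≤ ∫ x, ‖v x‖ * G x ∂ν₂ := by
  -- The common regular majorant `ρ` allows a single approximation in L²(ρ) to serve both integrals.
  have c₁ := continuous_integral_comp_mul (π := id) (μ := ρ) measurable_id (by simpa using h₁) 2
    LipschitzWith.id rfl hF
  have hN : LipschitzWith 1 fun z : ℂ => (‖z‖ : ℂ) := by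
    refine LipschitzWith.of_dist_le_mul fun a b => ?_
    simp only [dist_eq_norm, ← Complex.ofReal_sub, Complex.norm_real, NNReal.coe_one, one_mul]
    exact abs_norm_sub_norm_le a b
  have c₂ := continuous_integral_comp_mul (π := id) (μ := ρ) measurable_id (by simpa using h₂) 2
    hN (by simp) hG.ofReal
  have key : ∀ w : Lp ℂ 2 ρ,
      ‖∫ x, w x * F x ∂ν₁‖ ≤ (∫ x, ((‖w x‖ : ℂ) * (G x : ℂ)) ∂ν₂).re := by
    refine fun w => (ContinuousMap.toLp_denseRange ℂ ρ ℂ (p := 2) (by simp)).induction_on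
      (p := fun w : Lp ℂ 2 ρ => ‖∫ x, w x * F x ∂ν₁‖ ≤ (∫ x, ((‖w x‖ : ℂ) * (G x : ℂ)) ∂ν₂).re) w
      (isClosed_le (by exact c₁.norm) (by exact Complex.continuous_re.comp c₂)) fun a => ?_
    have ha := ContinuousMap.coeFn_toLp (p := 2) (𝕜 := ℂ) ρ a
    have e₁ : ∫ x, (ContinuousMap.toLp 2 ρ ℂ a) x * F x ∂ν₁ = ∫ x, a x * F x ∂ν₁ :=
      integral_congr_ae (by filter_upwards [ae_mono h₁ ha] with x hx; rw [hx])
    have e₂ : ∫ x, ((‖(ContinuousMap.toLp 2 ρ ℂ a) x‖ : ℂ) * (G x : ℂ)) ∂ν₂ =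
        ((∫ x, ‖a x‖ * G x ∂ν₂ : ℝ) : ℂ) := by
      rw [← integral_complex_ofReal]
      exact integral_congr_ae (by filter_upwards [ae_mono h₂ ha] with x hx; rw [hx]; simp)
    rw [e₁, e₂, Complex.ofReal_re]
    exact h a
  have e₁ : ∫ x, (hv.toLp v) x * F x ∂ν₁ = ∫ x, v x * F x ∂ν₁ :=
    integral_congr_ae (by filter_upwards [ae_mono h₁ hv.coeFn_toLp] with x hx; rw [hx])
  have e₂ : ∫ x, ((‖(hv.toLp v) x‖ : ℂ) * (G x : ℂ)) ∂ν₂ =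
      ((∫ x, ‖v x‖ * G x ∂ν₂ : ℝ) : ℂ) := by
    rw [← integral_complex_ofReal]
    exact integral_congr_ae (by filter_upwards [ae_mono h₂ hv.coeFn_toLp] with x hx; rw [hx]; simp)
  have := key (hv.toLp v)
  rwa [e₁, e₂, Complex.ofReal_re] at this

theorem ae_norm_le_of_forall_continuousMap {μ : Measure X} [IsFiniteMeasure μ] [μ.Regular]
    {F : X → ℂ} {G : X → ℝ} (hF : MemLp F 2 μ) (hG : MemLp G 2 μ)
    (h : ∀ v : C(X, ℂ), ‖∫ x, v x * F x ∂μ‖ ≤ ∫ x, ‖v x‖ * G x ∂μ) :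
    ∀ᵐ x ∂μ, ‖F x‖ ≤ G x := by
  set F' := hF.1.mk F with hF'
  set G' := hG.1.mk G with hG'
  have mF : Measurable F' := hF.1.stronglyMeasurable_mk.measurable
  have mG : Measurable G' := hG.1.stronglyMeasurable_mk.measurable
  set E : Set X := {x | G' x < ‖F' x‖} with hE
  have mE : MeasurableSet E := measurableSet_lt mG mF.norm
  obtain ⟨u, mu, nu, uF⟩ := exists_measurable_unimodular_mul mF
  -- The test function is the phase that rotates `F'` to its modulus, cut to the set where the claim
  -- fails: it yields ∫_E (|F| − G) ≤ 0 with an integrand that is positive on E.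
  set v : X → ℂ := E.indicator u with hv
  have mv : Measurable v := mu.indicator mE
  have bv : ∀ x, ‖v x‖ ≤ 1 := fun x => by
    by_cases hx : x ∈ E
    · simp [hv, hx, nu]
    · simp [hv, hx]
  have h2 := norm_integral_mul_le_of_forall_continuousMap le_rfl le_rfl hF hG h
    (MemLp.of_bound mv.aestronglyMeasurable 1 (.of_forall bv))
  have e1 : ∫ x, v x * F x ∂μ = ((∫ x, E.indicator (fun x => ‖F' x‖) x ∂μ : ℝ) : ℂ) := by
    rw [← integral_complex_ofReal]
    refine integral_congr_ae ?_
    filter_upwards [hF.1.ae_eq_mk] with x hx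
    by_cases hxE : x ∈ E
    · simp only [hv, Set.indicator_of_mem hxE]
      rw [hx, ← hF', uF]
    · simp [hv, hxE]
  have iF : Integrable (E.indicator fun x => ‖F' x‖) μ :=
    ((hF.integrable (by norm_num)).congr hF.1.ae_eq_mk).norm.indicator mE
  have iG : Integrable (E.indicator G') μ :=
    ((hG.integrable (by norm_num)).congr hG.1.ae_eq_mk).indicator mE
  have h3 : ∫ x, ‖v x‖ * G x ∂μ = ∫ x, E.indicator G' x ∂μ := by
    refine integral_congr_ae ?_
    filter_upwards [hG.1.ae_eq_mk] with x hx
    by_cases hxE : x ∈ E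
    · simp only [hv, Set.indicator_of_mem hxE, nu, one_mul]
      exact hx
    · simp [hv, hxE]
  rw [e1, Complex.norm_real, Real.norm_eq_abs] at h2
  have h4 := (le_abs_self _).trans (h2.trans h3.le)
  have h5 : ∀ᵐ x ∂μ, E.indicator (fun x => ‖F' x‖) x - E.indicator G' x = 0 := by
    have : 0 ≤ᵐ[μ] fun x => E.indicator (fun x => ‖F' x‖) x - E.indicator G' x :=
      .of_forall fun x => by
        by_cases hxE : x ∈ E
        · simpa [hxE] using (show G' x < ‖F' x‖ from hxE).le
        · simp [hxE]
    refine (integral_eq_zero_iff_of_nonneg_ae this (iF.sub iG)).1 ?_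
    refine le_antisymm ?_ (integral_nonneg_of_ae this)
    rw [integral_sub iF iG]
    linarith
  filter_upwards [h5, hF.1.ae_eq_mk, hG.1.ae_eq_mk] with x hx h1 h2
  rw [h1, h2]
  by_contra hlt
  have hxE : x ∈ E := not_le.1 hlt
  simp only [Set.indicator_of_mem hxE] at hx
  have : G' x < ‖F' x‖ := hxE
  linarith

/-- The dual of `C(X) ⊆ L¹(μ)` is `L^∞(μ)`. -/
theorem exists_density_of_norm_le {μ : Measure X} [IsFiniteMeasure μ] [μ.Regular]
    (φ : C(X, ℂ) →ₗ[ℂ] ℂ) {C : ℝ} (hC : 0 ≤ C) (h : ∀ v, ‖φ v‖ ≤ C * ∫ x, ‖v x‖ ∂μ) :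
    ∃ F : X → ℂ, AEStronglyMeasurable F μ ∧ (∀ᵐ x ∂μ, ‖F x‖ ≤ C) ∧
      ∀ v, φ v = ∫ x, v x * F x ∂μ := by
  set e : C(X, ℂ) →ₗ[ℂ] Lp ℂ 2 μ := (ContinuousMap.toLp 2 μ ℂ : C(X, ℂ) →L[ℂ] _).toLinearMap
    with he
  have hd : DenseRange e := ContinuousMap.toLp_denseRange ℂ μ ℂ (by simp)
  have hb : ∃ D : ℝ, ∀ v, ‖φ v‖ ≤ D * ‖e v‖ := by
    refine ⟨C * (eLpNorm (fun _ : X => (1 : ℂ)) 2 μ).toReal, fun v => (h v).trans ?_⟩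
    rw [mul_assoc]
    refine mul_le_mul_of_nonneg_left ?_ hC
    have := norm_integral_mul_le_eLpNorm (v.memLp_of_isFiniteMeasure 2 μ)
      (memLp_const (μ := μ) (p := 2) (1 : ℂ))
    have hv : eLpNorm (e v) 2 μ = eLpNorm v 2 μ :=
      eLpNorm_congr_ae (ContinuousMap.coeFn_toLp (𝕜 := ℂ) μ v)
    rw [mul_comm, Lp.norm_def, hv]
    simpa using this
  -- On a finite measure space the L¹ bound implies an L² bound, so the Hilbert space representation
  -- supplies a density. The constant `C` is recovered afterwards by comparing this density with a
  -- constant function.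
  set ψ : Lp ℂ 2 μ →L[ℂ] ℂ := φ.extendOfNorm e
  set f : Lp ℂ 2 μ := (InnerProductSpace.toDual ℂ _).symm ψ
  have hf : ∀ v, φ v = ∫ x, v x * conj (f x) ∂μ := fun v => by
    rw [← LinearMap.extendOfNorm_eq hd hb v, ← InnerProductSpace.toDual_symm_apply (y := ψ),
      L2.inner_def]
    refine integral_congr_ae ?_
    filter_upwards [ContinuousMap.coeFn_toLp (p := 2) (𝕜 := ℂ) μ v] with x hx
    have : (e v) x = v x := hx
    rw [this]
    rfl
  have hm : MemLp (fun x => conj (f x)) 2 μ := (Lp.memLp f).star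
  refine ⟨fun x => conj (f x), hm.1, ?_, hf⟩
  refine ae_norm_le_of_forall_continuousMap hm (memLp_const C) fun v => ?_
  rw [← hf, integral_mul_const, mul_comm]
  exact h v

end Density

/-! ### The modulus of a functional on C(X) -/

section Modulus

variable {X : Type*} [TopologicalSpace X]

/-- Riesz decomposition in `C(X, ℂ)`. -/
theorem exists_add_of_norm_le_add (f₁ f₂ : C(X, ℝ)) (h₁ : 0 ≤ f₁) (h₂ : 0 ≤ f₂) (g : C(X, ℂ))
    (hg : ∀ x, ‖g x‖ ≤ f₁ x + f₂ x) :
    ∃ g₁ g₂ : C(X, ℂ), g = g₁ + g₂ ∧ (∀ x, ‖g₁ x‖ ≤ f₁ x) ∧ ∀ x, ‖g₂ x‖ ≤ f₂ x := by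
  -- The decomposition splits g in the ratio a : b. Where a + b vanishes the quotient has the
  -- default value 0, and continuity survives because g vanishes there too and dominates the
  -- product.
  have key : ∀ a b : C(X, ℝ), 0 ≤ a → 0 ≤ b → (∀ x, ‖g x‖ ≤ a x + b x) →
      Continuous fun x => g x * ((a x / (a x + b x) : ℝ) : ℂ) := by
    intro a b ha hb hab
    rw [continuous_iff_continuousAt]
    intro x
    by_cases h0 : a x + b x = 0
    · have hgx : g x = 0 := by
        have := hab x
        rw [h0] at this
        simpa using this
      have hle : ∀ y, ‖g y * ((a y / (a y + b y) : ℝ) : ℂ)‖ ≤ ‖g y‖ := fun y => by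
        rw [norm_mul, Complex.norm_real, Real.norm_eq_abs]
        refine mul_le_of_le_one_right (norm_nonneg _) ?_
        have h1 : 0 ≤ a y := ha y
        have h2 : 0 ≤ b y := hb y
        rw [abs_of_nonneg (by positivity)]
        exact div_le_one_of_le₀ (by linarith) (by positivity)
      have : ContinuousAt (fun y => ‖g y‖) x := by fun_prop
      unfold ContinuousAt at this ⊢
      simp only [hgx, norm_zero] at this
      simp only [hgx, zero_mul]
      exact squeeze_zero_norm hle this
    · refine g.continuous.continuousAt.mul (Complex.continuous_ofReal.continuousAt.comp ?_)
      exact a.continuous.continuousAt.div (a.continuous.add b.continuous).continuousAt h0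
  have hle : ∀ a b : C(X, ℝ), 0 ≤ a → 0 ≤ b → (∀ x, ‖g x‖ ≤ a x + b x) →
      ∀ x, ‖g x * ((a x / (a x + b x) : ℝ) : ℂ)‖ ≤ a x := by
    intro a b ha hb hab x
    have h1 : 0 ≤ a x := ha x
    have h2 : 0 ≤ b x := hb x
    rw [norm_mul, Complex.norm_real, Real.norm_eq_abs, abs_of_nonneg (by positivity)]
    by_cases h0 : a x + b x = 0
    · simpa [h0] using h1
    · calc ‖g x‖ * (a x / (a x + b x)) ≤ (a x + b x) * (a x / (a x + b x)) := by
            gcongr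
            exact hab x
        _ = a x := by field_simp
  have hg' : ∀ x, ‖g x‖ ≤ f₂ x + f₁ x := fun x => by rw [add_comm]; exact hg x
  refine ⟨⟨_, key f₁ f₂ h₁ h₂ hg⟩, ⟨_, key f₂ f₁ h₂ h₁ hg'⟩, ?_, hle f₁ f₂ h₁ h₂ hg,
    hle f₂ f₁ h₂ h₁ hg'⟩
  ext x
  by_cases h0 : f₁ x + f₂ x = 0
  · have := hg x
    rw [h0] at this
    have : g x = 0 := by simpa using this
    simp [this]
  · have h0' : f₂ x + f₁ x ≠ 0 := by rwa [add_comm]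
    simp only [ContinuousMap.add_apply, ContinuousMap.coe_mk, ← mul_add, ← Complex.ofReal_add]
    rw [add_comm (f₂ x), ← add_div, div_self h0]
    simp

/-- The values of the norm of `φ` on the order interval of `C(X, ℂ)` given by `f`. -/
def modulusSet (φ : C(X, ℂ) →L[ℂ] ℂ) (f : C(X, ℝ)) : Set ℝ :=
  {c | ∃ g : C(X, ℂ), (∀ x, ‖g x‖ ≤ f x) ∧ c = ‖φ g‖}

theorem modulusSet_nonempty (φ : C(X, ℂ) →L[ℂ] ℂ) {f : C(X, ℝ)} (hf : 0 ≤ f) :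
    (modulusSet φ f).Nonempty :=
  ⟨0, 0, fun x => by simpa using hf x, by simp⟩

variable [CompactSpace X]

theorem bddAbove_modulusSet (φ : C(X, ℂ) →L[ℂ] ℂ) (f : C(X, ℝ)) :
    BddAbove (modulusSet φ f) := by
  refine ⟨‖φ‖ * ‖f‖, ?_⟩
  rintro _ ⟨g, hg, rfl⟩
  refine (φ.le_opNorm g).trans ?_
  gcongr
  refine (ContinuousMap.norm_le _ (norm_nonneg _)).2 fun x => (hg x).trans ?_
  exact (le_abs_self _).trans (f.norm_coe_le_norm x)

theorem norm_le_sSup_modulusSet (φ : C(X, ℂ) →L[ℂ] ℂ) {f : C(X, ℝ)} {g : C(X, ℂ)}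
    (hg : ∀ x, ‖g x‖ ≤ f x) : ‖φ g‖ ≤ sSup (modulusSet φ f) :=
  le_csSup (bddAbove_modulusSet φ f) ⟨g, hg, rfl⟩

theorem sSup_modulusSet_nonneg (φ : C(X, ℂ) →L[ℂ] ℂ) {f : C(X, ℝ)} (hf : 0 ≤ f) :
    0 ≤ sSup (modulusSet φ f) := by
  simpa using norm_le_sSup_modulusSet φ (f := f) (g := 0) fun x => by simpa using hf x

theorem sSup_modulusSet_add (φ : C(X, ℂ) →L[ℂ] ℂ) {f₁ f₂ : C(X, ℝ)} (h₁ : 0 ≤ f₁)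
    (h₂ : 0 ≤ f₂) :
    sSup (modulusSet φ (f₁ + f₂)) = sSup (modulusSet φ f₁) + sSup (modulusSet φ f₂) := by
  apply le_antisymm
  · refine csSup_le (modulusSet_nonempty φ (add_nonneg h₁ h₂)) ?_
    rintro _ ⟨g, hg, rfl⟩
    obtain ⟨g₁, g₂, rfl, hg₁, hg₂⟩ := exists_add_of_norm_le_add f₁ f₂ h₁ h₂ g hg
    rw [map_add]
    exact (norm_add_le _ _).trans
      (add_le_add (norm_le_sSup_modulusSet φ hg₁) (norm_le_sSup_modulusSet φ hg₂))
  · rw [← le_sub_iff_add_le]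
    refine csSup_le (modulusSet_nonempty φ h₁) ?_
    rintro _ ⟨g₁, hg₁, rfl⟩
    rw [le_sub_comm]
    refine csSup_le (modulusSet_nonempty φ h₂) ?_
    rintro _ ⟨g₂, hg₂, rfl⟩
    rw [le_sub_iff_add_le]
    -- Rotating `g₁` and `g₂` by constant phases makes both values of φ nonnegative, so that their
    -- norms add.
    obtain ⟨u, -, hu, e⟩ := exists_measurable_unimodular_mul (F := (id : ℂ → ℂ)) measurable_id
    simp only [id] at e
    have : ‖φ (u (φ g₁) • g₁ + u (φ g₂) • g₂)‖ = ‖φ g₂‖ + ‖φ g₁‖ := by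
      rw [map_add, map_smul, map_smul, smul_eq_mul, smul_eq_mul, e, e, ← Complex.ofReal_add,
        Complex.norm_real, Real.norm_eq_abs, abs_of_nonneg (by positivity), add_comm]
    rw [← this]
    refine norm_le_sSup_modulusSet φ fun x => ?_
    simp only [ContinuousMap.add_apply, ContinuousMap.smul_apply, smul_eq_mul]
    refine (norm_add_le _ _).trans ?_
    rw [norm_mul, norm_mul, hu, hu, one_mul, one_mul]
    exact add_le_add (hg₁ x) (hg₂ x)

theorem sSup_modulusSet_smul_le (φ : C(X, ℂ) →L[ℂ] ℂ) {f : C(X, ℝ)} (hf : 0 ≤ f) {c : ℝ}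
    (hc : 0 < c) : sSup (modulusSet φ (c • f)) ≤ c * sSup (modulusSet φ f) := by
  refine csSup_le (modulusSet_nonempty φ (smul_nonneg hc.le hf)) ?_
  rintro _ ⟨g, hg, rfl⟩
  have h : ‖φ ((c⁻¹ : ℂ) • g)‖ ≤ sSup (modulusSet φ f) := by
    refine norm_le_sSup_modulusSet φ fun x => ?_
    have := hg x
    simp only [ContinuousMap.smul_apply, smul_eq_mul, norm_mul, norm_inv, Complex.norm_real,
      Real.norm_eq_abs, abs_of_pos hc] at this ⊢
    rwa [inv_mul_le_iff₀ hc]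
  rw [map_smul, norm_smul, norm_inv, Complex.norm_real, Real.norm_eq_abs, abs_of_pos hc,
    inv_mul_le_iff₀ hc] at h
  exact h

theorem sSup_modulusSet_smul (φ : C(X, ℂ) →L[ℂ] ℂ) {f : C(X, ℝ)} (hf : 0 ≤ f) {c : ℝ}
    (hc : 0 ≤ c) : sSup (modulusSet φ (c • f)) = c * sSup (modulusSet φ f) := by
  rcases hc.eq_or_lt with rfl | hc
  · have := sSup_modulusSet_add φ (le_refl (0 : C(X, ℝ))) (le_refl 0)
    rw [add_zero] at this
    rw [zero_smul, zero_mul]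
    linarith
  · refine le_antisymm (sSup_modulusSet_smul_le φ hf hc) ?_
    have := sSup_modulusSet_smul_le φ (smul_nonneg hc.le hf) (inv_pos.2 hc)
    rw [smul_smul, inv_mul_cancel₀ hc.ne', one_smul, le_inv_mul_iff₀ hc] at this
    exact this

end Modulus

/-! ### Riesz–Markov–Kakutani for complex functionals -/

section RieszMarkovKakutani

open scoped NNReal CompactlySupported

variable {X : Type*} [TopologicalSpace X]

/-- A nonnegative compactly supported function as an element of `C(X, ℝ)`. -/
def realOfNNReal (f : C_c(X, ℝ≥0)) : C(X, ℝ) := ⟨fun x => f x, by fun_prop⟩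

theorem realOfNNReal_nonneg (f : C_c(X, ℝ≥0)) : 0 ≤ realOfNNReal f := fun x => (f x).2

variable [CompactSpace X]

/-- The modulus of a functional on `C(X, ℂ)`, on nonnegative functions. -/
noncomputable def modulusFunctional (φ : C(X, ℂ) →L[ℂ] ℂ) : C_c(X, ℝ≥0) →ₗ[ℝ≥0] ℝ≥0 where
  toFun f := ⟨sSup (modulusSet φ (realOfNNReal f)),
    sSup_modulusSet_nonneg φ (realOfNNReal_nonneg f)⟩
  map_add' f g := by
    refine NNReal.eq ?_
    exact (congrArg (fun k => sSup (modulusSet φ k)) (by ext; rfl)).trans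
      (sSup_modulusSet_add φ (realOfNNReal_nonneg f) (realOfNNReal_nonneg g))
  map_smul' c f := by
    refine NNReal.eq ?_
    exact (congrArg (fun k => sSup (modulusSet φ k)) (by ext; rfl)).trans
      (sSup_modulusSet_smul φ (realOfNNReal_nonneg f) c.2)

variable [T2Space X] [MeasurableSpace X] [BorelSpace X]

/-- The Riesz–Markov–Kakutani theorem for complex functionals, with polar decomposition. -/
theorem exists_measure_unimodular_of_clm (φ : C(X, ℂ) →L[ℂ] ℂ) :
    ∃ (ν : Measure X) (lam : X → ℂ), IsFiniteMeasure ν ∧ ν.Regular ∧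
      AEStronglyMeasurable lam ν ∧ (∀ᵐ x ∂ν, ‖lam x‖ = 1) ∧
      (∀ g, φ g = ∫ x, g x * lam x ∂ν) ∧
      ∀ f : C(X, ℝ), 0 ≤ f → IsLUB (modulusSet φ f) (∫ x, f x ∂ν) := by
  set ν : Measure X := NNRealRMK.rieszMeasure (modulusFunctional φ) with hν
  have hreg : ν.Regular := NNRealRMK.rieszMeasure_regular _
  have hlub : ∀ f : C(X, ℝ), 0 ≤ f → IsLUB (modulusSet φ f) (∫ x, f x ∂ν) := by
    intro f hf
    let f' : C_c(X, ℝ≥0) := ⟨⟨fun x => ⟨f x, hf x⟩, by fun_prop⟩, HasCompactSupport.of_compactSpace _⟩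
    have h1 := NNRealRMK.integral_rieszMeasure (modulusFunctional φ) f'
    have h2 : realOfNNReal f' = f := by ext; rfl
    have h3 : ∫ x, f x ∂ν = sSup (modulusSet φ f) := by
      rw [← h2]; exact h1
    rw [h3]
    exact isLUB_csSup (modulusSet_nonempty φ hf) (bddAbove_modulusSet φ f)
  have hfin : IsFiniteMeasure ν := ⟨isCompact_univ.measure_lt_top⟩
  have hle : ∀ v, ‖φ v‖ ≤ 1 * ∫ x, ‖v x‖ ∂ν := fun v => by
    rw [one_mul]
    exact (hlub ⟨fun x => ‖v x‖, by fun_prop⟩ fun x => norm_nonneg _).1 ⟨v, fun x => le_rfl, rfl⟩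
  obtain ⟨F, mF, bF, eF⟩ := exists_density_of_norm_le φ.toLinearMap zero_le_one hle
  have eF' : ∀ v, φ v = ∫ x, v x * F x ∂ν := eF
  refine ⟨ν, F, hfin, hreg, mF, ?_, eF, hlub⟩
  have iF : Integrable F ν := Integrable.of_bound mF 1 bF
  -- The total mass of ν is the supremum of |φ g| over |g| ≤ 1, hence at most ∫ |F| dν. Together
  -- with |F| ≤ 1 this forces |F| = 1 almost everywhere.
  have h1 : ∫ _, (1 : ℝ) ∂ν ≤ ∫ x, ‖F x‖ ∂ν := by
    refine (hlub 1 zero_le_one).2 ?_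
    rintro _ ⟨g, hg, rfl⟩
    rw [eF']
    refine (norm_integral_le_integral_norm _).trans ?_
    refine integral_mono_of_nonneg (.of_forall fun _ => norm_nonneg _) iF.norm
      (.of_forall fun x => ?_)
    simp only [norm_mul]
    exact mul_le_of_le_one_left (norm_nonneg _) (hg x)
  have h2 : 0 ≤ᵐ[ν] fun x => 1 - ‖F x‖ := by
    filter_upwards [bF] with x hx
    simpa using hx
  have h3 : (fun x => 1 - ‖F x‖) =ᵐ[ν] 0 := by
    refine (integral_eq_zero_iff_of_nonneg_ae h2 ((integrable_const _).sub iF.norm)).1 ?_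
    refine le_antisymm ?_ (integral_nonneg_of_ae h2)
    rw [integral_sub (integrable_const _) iF.norm]
    linarith
  filter_upwards [h3] with x hx
  simp only [Pi.zero_apply] at hx
  linarith

end RieszMarkovKakutani

/-! ### Integration against a complex measure with unimodular density -/

section VectorMeasureIntegral

variable {Z : Type*} [MeasurableSpace Z] {ν : Measure Z} {lam : Z → ℂ}

theorem variation_withDensityᵥ_of_norm_eq_one (hi : Integrable lam ν)
    (h1 : ∀ᵐ z ∂ν, ‖lam z‖ = 1) : (ν.withDensityᵥ lam).variation = ν := by
  rw [Measure.variation_withDensityᵥ hi]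
  conv_rhs => rw [← withDensity_one (μ := ν)]
  refine withDensity_congr_ae ?_
  filter_upwards [h1] with z hz
  rw [← ofReal_norm, hz]
  simp

/-- The variation of λν is ν itself, so integrability means the same for both. The identity is then
checked on indicators and carried on by additivity and L¹-continuity. -/
theorem integral_withDensityᵥ_of_norm_eq_one (hi : Integrable lam ν)
    (h1 : ∀ᵐ z ∂ν, ‖lam z‖ = 1) {f : Z → ℂ} (hf : Integrable f ν) :
    VectorMeasure.integral (ν.withDensityᵥ lam) f (ContinuousLinearMap.mul ℝ ℂ) =
      ∫ z, f z * lam z ∂ν := by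
  have hv := variation_withDensityᵥ_of_norm_eq_one hi h1
  have hb : MemLp lam ∞ ν :=
    memLp_top_of_bound hi.1 1 (by filter_upwards [h1] with z hz using hz.le)
  have hint : ∀ {g : Z → ℂ}, Integrable g ν → Integrable (fun z => g z * lam z) ν := fun hg =>
    hg.mul_of_top_left hb
  rw [← hv] at hf
  refine Integrable.induction (μ := (ν.withDensityᵥ lam).variation)
    (fun f => VectorMeasure.integral (ν.withDensityᵥ lam) f (ContinuousLinearMap.mul ℝ ℂ) =
      ∫ z, f z * lam z ∂ν) ?_ ?_ ?_ ?_ hf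
  · intro c s hs hs'
    rw [VectorMeasure.integral_eq_setToFun, setToFun_indicator_const _ hs hs'.ne]
    have : (fun z => s.indicator (fun _ => c) z * lam z) = s.indicator fun z => c * lam z := by
      ext z
      by_cases hz : z ∈ s <;> simp [hz]
    rw [this, integral_indicator hs, integral_const_mul, ← withDensityᵥ_apply hi hs]
    rfl
  · intro f g _ hf hg ef eg
    rw [VectorMeasure.integral_add hf hg, ef, eg]
    rw [hv] at hf hg
    rw [← integral_add (hint hf) (hint hg)]
    simp [add_mul]
  · refine isClosed_eq VectorMeasure.continuous_integral ?_
    exact continuous_integral_comp_mul (μ := (ν.withDensityᵥ lam).variation) (π := id)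
      measurable_id (by simp [hv]) 1 (q := ∞) LipschitzWith.id rfl hb
  · intro f g hfg _ ef
    rw [← VectorMeasure.integral_congr_ae hfg, ef]
    rw [hv] at hfg
    exact integral_congr_ae (by filter_upwards [hfg] with z hz; rw [hz])

end VectorMeasureIntegral

/-! ### Elementary tensors in C(K × K) -/

section Tensor

theorem BorelProd.continuous_fst {K L : Type*} [TopologicalSpace K] [TopologicalSpace L] :
    Continuous fun z : BorelProd K L => z.1 :=
  (_root_.continuous_fst : Continuous fun z : K × L => z.1)

theorem BorelProd.continuous_snd {K L : Type*} [TopologicalSpace K] [TopologicalSpace L] :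
    Continuous fun z : BorelProd K L => z.2 :=
  (_root_.continuous_snd : Continuous fun z : K × L => z.2)

/-- A real continuous function, viewed as a complex one. -/
noncomputable def ContinuousMap.complexify {K : Type*} [TopologicalSpace K] (f : C(K, ℝ)) : C(K, ℂ) :=
  ⟨fun x => (f x : ℂ), by fun_prop⟩

variable {K : Type*} [TopologicalSpace K]

/-- The function `(x, y) ↦ a x * b y`. -/
noncomputable def tensor (a b : C(K, ℂ)) : C(BorelProd K K, ℂ) :=
  ⟨fun z => a z.1 * b z.2,
    (a.continuous.comp BorelProd.continuous_fst).mul (b.continuous.comp BorelProd.continuous_snd)⟩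

@[simp]
theorem tensor_apply (a b : C(K, ℂ)) (z : BorelProd K K) : tensor a b z = a z.1 * b z.2 := rfl

/-- The set of elementary tensors. -/
def tensorSubmonoid (K : Type*) [TopologicalSpace K] : Submonoid C(BorelProd K K, ℂ) where
  carrier := Set.range fun p : C(K, ℂ) × C(K, ℂ) => tensor p.1 p.2
  one_mem' := ⟨(1, 1), by ext; simp⟩
  mul_mem' := by
    rintro _ _ ⟨p, rfl⟩ ⟨q, rfl⟩
    exact ⟨(p.1 * q.1, p.2 * q.2), by ext; simp; ring⟩

/-- Stone–Weierstrass: tensors are closed under products and conjugation, so their span is already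
the star algebra they generate, and Urysohn functions of one coordinate separate points. -/
theorem dense_span_tensor [CompactSpace K] [T2Space K] :
    Dense (Submodule.span ℂ (Set.range fun p : C(K, ℂ) × C(K, ℂ) => tensor p.1 p.2) :
      Set C(BorelProd K K, ℂ)) := by
  set A := StarAlgebra.adjoin ℂ (tensorSubmonoid K : Set C(BorelProd K K, ℂ)) with hA
  have hstar : star (tensorSubmonoid K : Set C(BorelProd K K, ℂ)) ⊆ tensorSubmonoid K := by
    rintro w ⟨p, hp⟩
    refine ⟨(star p.1, star p.2), ?_⟩
    rw [← star_star w, ← hp]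
    ext
    simp
  have hsub : ∀ a b : C(K, ℂ), tensor a b ∈ A := fun a b =>
    StarAlgebra.subset_adjoin ℂ _ ⟨(a, b), rfl⟩
  have hsep : A.SeparatesPoints := by
    intro z w hzw
    have : z.1 ≠ w.1 ∨ z.2 ≠ w.2 := by
      by_contra! h
      exact hzw (Prod.ext h.1 h.2)
    rcases this with h | h
    · obtain ⟨f, h0, h1, -⟩ := exists_continuous_zero_one_of_isClosed (isClosed_singleton (x := z.1))
        (isClosed_singleton (x := w.1)) (by simpa using h)
      refine ⟨_, ⟨tensor f.complexify 1, hsub _ _, rfl⟩, ?_⟩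
      have h0' : f z.1 = 0 := h0 rfl
      have h1' : f w.1 = 1 := h1 rfl
      simp [ContinuousMap.complexify, h0', h1']
    · obtain ⟨f, h0, h1, -⟩ := exists_continuous_zero_one_of_isClosed (isClosed_singleton (x := z.2))
        (isClosed_singleton (x := w.2)) (by simpa using h)
      refine ⟨_, ⟨tensor 1 f.complexify, hsub _ _, rfl⟩, ?_⟩
      have h0' : f z.2 = 0 := h0 rfl
      have h1' : f w.2 = 1 := h1 rfl
      simp [ContinuousMap.complexify, h0', h1']
  have htop := ContinuousMap.starSubalgebra_topologicalClosure_eq_top_of_separatesPoints A hsep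
  have hspan : (A : Set C(BorelProd K K, ℂ)) ⊆
      Submodule.span ℂ (Set.range fun p : C(K, ℂ) × C(K, ℂ) => tensor p.1 p.2) := by
    intro w hw
    have hw' : w ∈ Subalgebra.toSubmodule A.toSubalgebra := hw
    rw [hA, StarAlgebra.adjoin_eq_span, Set.union_eq_self_of_subset_right hstar,
      Submonoid.closure_eq] at hw'
    exact hw'
  refine Dense.mono hspan ?_
  rw [dense_iff_closure_eq, ← StarSubalgebra.topologicalClosure_coe, htop]
  rfl

/-- Continuous functionals on `C(K × K)` are determined by their values on tensors. -/
theorem clm_ext_of_tensor [CompactSpace K] [T2Space K] {φ ψ : C(BorelProd K K, ℂ) →L[ℂ] ℂ}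
    (h : ∀ a b, φ (tensor a b) = ψ (tensor a b)) : φ = ψ := by
  refine ContinuousLinearMap.ext_on dense_span_tensor ?_
  rintro _ ⟨p, rfl⟩
  exact h _ _

/-- The linear combinations of elementary tensors. -/
noncomputable def tensorSum (K : Type*) [TopologicalSpace K] :
    (C(K, ℂ) × C(K, ℂ) →₀ ℂ) →ₗ[ℂ] C(BorelProd K K, ℂ) :=
  Finsupp.linearCombination ℂ fun p => tensor p.1 p.2

theorem denseRange_tensorSum [CompactSpace K] [T2Space K] : DenseRange (tensorSum K) := by
  have := dense_span_tensor (K := K)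
  rw [← Finsupp.range_linearCombination] at this
  exact this

theorem integrable_mul_continuousMap {Z 𝕜 : Type*} [RCLike 𝕜] [TopologicalSpace Z]
    [CompactSpace Z] [MeasurableSpace Z] [BorelSpace Z] {ν : Measure Z} {F : Z → 𝕜}
    (hF : Integrable F ν) (w : C(Z, 𝕜)) : Integrable (fun z => F z * w z) ν := by
  simpa only [mul_comm] using
    hF.bdd_mul w.continuous.aestronglyMeasurable (.of_forall w.norm_coe_le_norm)

/-- Integration against an integrable density, as a functional on continuous functions. -/
noncomputable def integralMulCLM {Z : Type*} [TopologicalSpace Z] [CompactSpace Z]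
    [MeasurableSpace Z] [BorelSpace Z] {ν : Measure Z} {F : Z → ℂ} (hF : Integrable F ν) :
    C(Z, ℂ) →L[ℂ] ℂ :=
  have hi : ∀ w : C(Z, ℂ), Integrable (fun z => w z * F z) ν := fun w =>
    hF.bdd_mul w.continuous.aestronglyMeasurable (.of_forall w.norm_coe_le_norm)
  LinearMap.mkContinuous
    { toFun := fun w => ∫ z, w z * F z ∂ν
      map_add' := fun w w' => by
        rw [← integral_add (hi w) (hi w')]
        simp [add_mul]
      map_smul' := fun c w => by
        rw [RingHom.id_apply, smul_eq_mul, ← integral_const_mul]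
        simp [mul_assoc] }
    (∫ z, ‖F z‖ ∂ν) fun w => by
      refine (norm_integral_le_integral_norm _).trans ?_
      rw [mul_comm, ← integral_const_mul]
      refine integral_mono (hi w).norm (hF.norm.const_mul _) fun z => ?_
      simp only [norm_mul]
      gcongr
      exact w.norm_coe_le_norm z

theorem integralMulCLM_apply {Z : Type*} [TopologicalSpace Z] [CompactSpace Z]
    [MeasurableSpace Z] [BorelSpace Z] {ν : Measure Z} {F : Z → ℂ} (hF : Integrable F ν)
    (w : C(Z, ℂ)) : integralMulCLM hF w = ∫ z, w z * F z ∂ν := rfl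

end Tensor

/-! ### Order bounds of an operator control its bilinear functional -/

section BilinearBound

theorem coeFn_linearCombination {V K : Type*} [AddCommGroup V] [Module ℂ V] [MeasurableSpace K]
    {μ : Measure K} (S : V →ₗ[ℂ] Lp ℂ 1 μ) {ι : Type*} (s : Finset ι) (c : ι → ℂ) (a : ι → V) :
    S (∑ i ∈ s, c i • a i) =ᵐ[μ] fun y => ∑ i ∈ s, c i * S (a i) y := by
  rw [map_sum]
  refine (Lp.coeFn_finsetSum s fun i => S (c i • a i)).trans ?_
  have h : ∀ᵐ y ∂μ, ∀ i ∈ s, S (c i • a i) y = c i * S (a i) y := by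
    refine (ae_ball_iff s.countable_toSet).2 fun i _ => ?_
    rw [map_smul]
    filter_upwards [Lp.coeFn_smul (c i) (S (a i))] with y hy
    rw [hy]
    rfl
  filter_upwards [h] with y hy
  rw [Finset.sum_apply]
  exact Finset.sum_congr rfl hy

variable {K : Type*} [TopologicalSpace K] [CompactSpace K] [MeasurableSpace K] {μ : Measure K}

/-- If `k` dominates `S` on the order interval of `f`, then almost everywhere it dominates all
linear combinations at once. -/
theorem ae_forall_norm_sum_le (S : C(K, ℂ) →ₗ[ℂ] Lp ℂ 1 μ) {f : C(K, ℝ)} (hf : 0 ≤ f)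
    {k : K → ℝ} (hS : ∀ g : C(K, ℂ), (∀ x, ‖g x‖ ≤ f x) → ∀ᵐ y ∂μ, ‖S g y‖ ≤ k y)
    {ι : Type*} (s : Finset ι) (a : ι → C(K, ℂ)) :
    ∀ᵐ y ∂μ, ∀ c : s → ℂ,
      ‖∑ i, c i * S (f.complexify * a i) y‖ ≤ ‖∑ i, c i • a i‖ * k y := by
  have h1 : ∀ c : s → ℂ, ∀ᵐ y ∂μ,
      ‖∑ i, c i * S (f.complexify * a i) y‖ ≤ ‖∑ i, c i • a i‖ * k y := by
    intro c
    have hsum := coeFn_linearCombination S Finset.univ c fun i : s => f.complexify * a i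
    set u : C(K, ℂ) := ∑ i, c i • a i with hu
    have hfu : ∑ i : s, c i • (f.complexify * a i) = f.complexify * u := by
      rw [hu, Finset.mul_sum]
      simp
    rw [hfu] at hsum
    by_cases h0 : u = 0
    · rw [h0, mul_zero, map_zero] at hsum
      filter_upwards [hsum, Lp.coeFn_zero ℂ 1 μ] with y h2 h3
      rw [← h2, h3, h0]
      simp
    · have hpos : 0 < ‖u‖ := norm_pos_iff.2 h0
      -- After normalisation f·u/‖u‖ lies in the order interval of f, where `k` is a bound.
      have h4 := hS ((‖u‖⁻¹ : ℂ) • (f.complexify * u)) fun x => by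
        have hfx : 0 ≤ f x := hf x
        simp only [ContinuousMap.smul_apply, ContinuousMap.mul_apply, smul_eq_mul, norm_mul,
          norm_inv, Complex.norm_real, ContinuousMap.complexify, ContinuousMap.coe_mk,
          Real.norm_eq_abs, abs_of_nonneg hfx, abs_of_pos hpos]
        rw [inv_mul_le_iff₀ hpos, mul_comm]
        exact mul_le_mul_of_nonneg_right (u.norm_coe_le_norm x) hfx
      rw [map_smul] at h4
      filter_upwards [hsum, h4, Lp.coeFn_smul (‖u‖⁻¹ : ℂ) (S (f.complexify * u))] with y h2 h3 h5
      rw [h5, Pi.smul_apply, norm_smul, norm_inv, Complex.norm_real, norm_norm,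
        inv_mul_le_iff₀ hpos] at h3
      rw [← h2]
      exact h3
  -- The exceptional set depends on c; a countable dense set of coefficients gives one null set, and
  -- both sides are continuous in c.
  have h2 := ae_all_iff.2 fun n => h1 (TopologicalSpace.denseSeq (s → ℂ) n)
  filter_upwards [h2] with y hy c
  refine (TopologicalSpace.denseRange_denseSeq (s → ℂ)).induction_on
    (p := fun c : s → ℂ => ‖∑ i, c i * S (f.complexify * a i) y‖ ≤ ‖∑ i, c i • a i‖ * k y)
    c (isClosed_le ?_ ?_) hy
  · fun_prop
  · fun_prop

variable [BorelSpace K]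

/-- At fixed y the second factors are just coefficients, so the pointwise bound compares with the
slice of the tensor sum at y. The weights `f` and `v` localise the estimate. -/
theorem norm_linearCombination_le (S : C(K, ℂ) →ₗ[ℂ] Lp ℂ 1 μ) {f v : C(K, ℝ)} (hf : 0 ≤ f)
    (hv : 0 ≤ v) {k : K → ℝ} (hk : Integrable k μ)
    (hS : ∀ g : C(K, ℂ), (∀ x, ‖g x‖ ≤ f x) → ∀ᵐ y ∂μ, ‖S g y‖ ≤ k y)
    (t : C(K, ℂ) × C(K, ℂ) →₀ ℂ) :
    ‖Finsupp.linearCombination ℂ (fun p : C(K, ℂ) × C(K, ℂ) =>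
        ∫ y, S (f.complexify * p.1) y * (v.complexify * p.2) y ∂μ) t‖ ≤
      ‖tensorSum K t‖ * ∫ y, k y * v y ∂μ := by
  have hi : ∀ p : C(K, ℂ) × C(K, ℂ),
      Integrable (fun y => t p * (S (f.complexify * p.1) y * (v.complexify * p.2) y)) μ := fun p =>
    (integrable_mul_continuousMap (L1.integrable_coeFn _) (v.complexify * p.2)).const_mul _
  have hkv : Integrable (fun y => k y * v y) μ :=
    integrable_mul_continuousMap hk v
  rw [Finsupp.linearCombination_apply, Finsupp.sum]
  simp only [smul_eq_mul, ← integral_const_mul]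
  rw [← integral_finsetSum _ fun p _ => hi p]
  refine norm_integral_le_of_norm_le (hkv.const_mul _) ?_
  have h0 := hS 0 fun x => by simpa using hf x
  filter_upwards [ae_forall_norm_sum_le S hf hS t.support fun p => p.1, h0] with y hy h0
  have hky : 0 ≤ k y := (norm_nonneg _).trans h0
  -- The coefficients depend on y, which is why the bound had to hold for all of them off a single
  -- null set.
  have h1 := hy fun p => t p * p.1.2 y
  have hvy : 0 ≤ v y := hv y
  have h2 : ‖∑ p : t.support, (t p * p.1.2 y) • p.1.1‖ ≤ ‖tensorSum K t‖ := by
    refine (ContinuousMap.norm_le _ (norm_nonneg _)).2 fun x => ?_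
    obtain ⟨z, hz₁, hz₂⟩ : ∃ z : BorelProd K K, z.1 = x ∧ z.2 = y := ⟨(x, y), rfl, rfl⟩
    refine le_of_eq_of_le ?_ ((tensorSum K t).norm_coe_le_norm z)
    rw [Finset.sum_coe_sort t.support fun p => (t p * p.2 y) • p.1]
    simp only [tensorSum, Finsupp.linearCombination_apply, Finsupp.sum, ContinuousMap.coe_sum,
      Finset.sum_apply, ContinuousMap.smul_apply, smul_eq_mul]
    refine congrArg norm (Finset.sum_congr rfl fun p _ => ?_)
    rw [tensor_apply, hz₁, hz₂]
    ring
  have h3 : ∑ p ∈ t.support, t p * (S (f.complexify * p.1) y * (v.complexify * p.2) y) =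
      v y * ∑ p : t.support, t p * p.1.2 y * S (f.complexify * p.1.1) y := by
    rw [Finset.sum_coe_sort t.support fun p => t p * p.2 y * S (f.complexify * p.1) y,
      Finset.mul_sum]
    refine Finset.sum_congr rfl fun p _ => ?_
    simp only [ContinuousMap.complexify, ContinuousMap.mul_apply, ContinuousMap.coe_mk]
    ring
  rw [h3, norm_mul, Complex.norm_real, Real.norm_eq_abs, abs_of_nonneg hvy, mul_comm, ← mul_assoc]
  refine mul_le_mul_of_nonneg_right (h1.trans ?_) hvy
  exact mul_le_mul_of_nonneg_right h2 hky

/-- The functional on `C(K × K)` given by an operator on `C(K)` that is contractive for the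
uniform norm. -/
theorem exists_clm_tensor [T2Space K] [IsFiniteMeasure μ] (S : C(K, ℂ) →ₗ[ℂ] Lp ℂ 1 μ)
    (hS : ∀ g : C(K, ℂ), (∀ x, ‖g x‖ ≤ 1) → ∀ᵐ y ∂μ, ‖S g y‖ ≤ 1) :
    ∃ Φ : C(BorelProd K K, ℂ) →L[ℂ] ℂ, ∀ a b, Φ (tensor a b) = ∫ y, S a y * b y ∂μ := by
  set β : (C(K, ℂ) × C(K, ℂ) →₀ ℂ) →ₗ[ℂ] ℂ :=
    Finsupp.linearCombination ℂ fun p => ∫ y, S p.1 y * p.2 y ∂μ with hβ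
  have hone : (1 : C(K, ℝ)).complexify = 1 := by
    ext
    simp [ContinuousMap.complexify]
  have hb : ∃ C : ℝ, ∀ t, ‖β t‖ ≤ C * ‖tensorSum K t‖ := by
    refine ⟨∫ y, 1 * (1 : C(K, ℝ)) y ∂μ, fun t => ?_⟩
    have := norm_linearCombination_le S (f := 1) (v := 1) zero_le_one zero_le_one
      (integrable_const 1) hS t
    rw [mul_comm]
    simpa only [hone, one_mul] using this
  refine ⟨β.extendOfNorm (tensorSum K), fun a b => ?_⟩
  have := LinearMap.extendOfNorm_eq denseRange_tensorSum hb (Finsupp.single (a, b) 1)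
  simpa [tensorSum, hβ] using this

theorem norm_clm_mul_le [T2Space K] (S : C(K, ℂ) →ₗ[ℂ] Lp ℂ 1 μ)
    {Φ : C(BorelProd K K, ℂ) →L[ℂ] ℂ} (hΦ : ∀ a b, Φ (tensor a b) = ∫ y, S a y * b y ∂μ)
    {f v : C(K, ℝ)} (hf : 0 ≤ f) (hv : 0 ≤ v) {k : K → ℝ} (hk : Integrable k μ)
    (hS : ∀ g : C(K, ℂ), (∀ x, ‖g x‖ ≤ f x) → ∀ᵐ y ∂μ, ‖S g y‖ ≤ k y)
    (w : C(BorelProd K K, ℂ)) :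
    ‖Φ (tensor f.complexify v.complexify * w)‖ ≤ ‖w‖ * ∫ y, k y * v y ∂μ := by
  refine denseRange_tensorSum.induction_on
    (p := fun w => ‖Φ (tensor f.complexify v.complexify * w)‖ ≤ ‖w‖ * ∫ y, k y * v y ∂μ) w
    (isClosed_le (by fun_prop) (by fun_prop)) fun t => ?_
  refine le_of_eq_of_le ?_ (norm_linearCombination_le S hf hv hk hS t)
  congr 1
  simp only [tensorSum, Finsupp.linearCombination_apply, Finsupp.sum, Finset.mul_sum, map_sum,
    mul_smul_comm, map_smul]
  refine Finset.sum_congr rfl fun p _ => ?_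
  rw [← hΦ]
  congr 2
  ext z
  simp
  ring

/-- The main estimate: the modulus of the functional `Φ` is controlled by order bounds of `S`. -/
theorem norm_clm_le_of_norm_le [T2Space K] (S : C(K, ℂ) →ₗ[ℂ] Lp ℂ 1 μ)
    {Φ : C(BorelProd K K, ℂ) →L[ℂ] ℂ} (hΦ : ∀ a b, Φ (tensor a b) = ∫ y, S a y * b y ∂μ)
    {f v : C(K, ℝ)} (hf : 0 ≤ f) (hv : 0 ≤ v) {k : K → ℝ} (hk : Integrable k μ)
    (hk0 : 0 ≤ᵐ[μ] k)
    (hS : ∀ g : C(K, ℂ), (∀ x, ‖g x‖ ≤ f x) → ∀ᵐ y ∂μ, ‖S g y‖ ≤ k y)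
    {w : C(BorelProd K K, ℂ)} (hw : ∀ z, ‖w z‖ ≤ f z.1 * v z.2) :
    ‖Φ w‖ ≤ ∫ y, k y * v y ∂μ := by
  have hI : 0 ≤ ∫ y, k y * v y ∂μ := by
    refine integral_nonneg_of_ae ?_
    filter_upwards [hk0] with y hy using mul_nonneg hy (hv y)
  have hε : ∀ ε : ℝ, 0 < ε → ‖Φ w‖ ≤ ‖Φ‖ * ε + ∫ y, k y * v y ∂μ := by
    intro ε hε
    have hfv : ∀ z : BorelProd K K, 0 ≤ f z.1 * v z.2 := fun z => mul_nonneg (hf _) (hv _)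
    have hfc : Continuous fun z : BorelProd K K => f z.1 * v z.2 :=
      (f.continuous.comp BorelProd.continuous_fst).mul (v.continuous.comp BorelProd.continuous_snd)
    have hne : ∀ z : BorelProd K K, ((f z.1 * v z.2 + ε : ℝ) : ℂ) ≠ 0 := fun z => by
      have := hfv z
      exact_mod_cast (by positivity : f z.1 * v z.2 + ε ≠ 0)
    -- `w` need not be a continuous multiple of f ⊗ v where the latter vanishes. Dividing by f ⊗ v +
    -- ε instead leaves a remainder of uniform norm at most ε.
    let ω : C(BorelProd K K, ℂ) := ⟨fun z => w z / ((f z.1 * v z.2 + ε : ℝ) : ℂ),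
      w.continuous.div (Complex.continuous_ofReal.comp (hfc.add continuous_const)) hne⟩
    have hnorm : ∀ z : BorelProd K K, ‖((f z.1 * v z.2 + ε : ℝ) : ℂ)‖ = f z.1 * v z.2 + ε := fun z => by
      have := hfv z
      rw [Complex.norm_real, Real.norm_eq_abs, abs_of_pos (by positivity)]
    have hω : ‖ω‖ ≤ 1 := by
      refine (ContinuousMap.norm_le _ zero_le_one).2 fun z => ?_
      have := hfv z
      simp only [ω, ContinuousMap.coe_mk, norm_div, hnorm]
      exact div_le_one_of_le₀ ((hw z).trans (by linarith)) (by positivity)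
    have hd : ‖w - tensor f.complexify v.complexify * ω‖ ≤ ε := by
      refine (ContinuousMap.norm_le _ hε.le).2 fun z => ?_
      have h0 := hfv z
      have : (w - tensor f.complexify v.complexify * ω) z =
          w z * ε / ((f z.1 * v z.2 + ε : ℝ) : ℂ) := by
        have h1 := hne z
        simp only [ω, ContinuousMap.sub_apply, ContinuousMap.mul_apply, tensor_apply,
          ContinuousMap.complexify, ContinuousMap.coe_mk]
        field_simp
        push_cast
        ring
      rw [this, norm_div, norm_mul, hnorm, Complex.norm_real, Real.norm_eq_abs, abs_of_pos hε,
        div_le_iff₀ (by positivity), mul_comm]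
      exact mul_le_mul_of_nonneg_left ((hw z).trans (by linarith)) hε.le
    calc ‖Φ w‖ = ‖Φ (w - tensor f.complexify v.complexify * ω) +
          Φ (tensor f.complexify v.complexify * ω)‖ := by rw [← map_add, sub_add_cancel]
      _ ≤ ‖Φ‖ * ε + ∫ y, k y * v y ∂μ := by
        refine (norm_add_le _ _).trans (add_le_add ((Φ.le_opNorm _).trans (by gcongr)) ?_)
        refine (norm_clm_mul_le S hΦ hf hv hk hS ω).trans ?_
        exact mul_le_of_le_one_left hI hω
  refine le_of_forall_pos_le_add fun δ hδ => ?_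
  have h1 := hε (δ / (‖Φ‖ + 1)) (by positivity)
  have h2 : ‖Φ‖ * (δ / (‖Φ‖ + 1)) ≤ δ := by
    rw [mul_div_assoc', div_le_iff₀ (by positivity)]
    nlinarith [norm_nonneg Φ]
  linarith

end BilinearBound

/-! ### Existence of the modulus and of the representing measures -/

section Existence

theorem coeFn_absL1 {K : Type*} [MeasurableSpace K] {μ : Measure K} (h : Lp ℂ 1 μ) :
    absL1 μ h =ᵐ[μ] fun y => ‖h y‖ :=
  (Lp.memLp h).norm.coeFn_toLp

theorem ae_norm_onContinuous_le {K : Type*} [TopologicalSpace K] [CompactSpace K]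
    [MeasurableSpace K] [BorelSpace K] {μ : Measure K} [IsFiniteMeasure μ]
    {T : Lp ℂ 1 μ →ₗ[ℂ] Lp ℂ 1 μ} (hT : IsAbsoluteContraction μ T)
    {c : ℝ} {g : C(K, ℂ)} (hg : ∀ x, ‖g x‖ ≤ c) :
    ∀ᵐ y ∂μ, ‖onContinuous μ T g y‖ ≤ c := by
  have h1 := hT.eLpNorm_top_le (ContinuousMap.toLp 1 μ ℂ g)
  have h2 : eLpNorm (ContinuousMap.toLp 1 μ ℂ g : Lp ℂ 1 μ) ∞ μ ≤ ENNReal.ofReal c := by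
    rw [eLpNorm_congr_ae (ContinuousMap.coeFn_toLp (𝕜 := ℂ) μ g), eLpNorm_exponent_top]
    exact eLpNormEssSup_le_of_ae_bound (.of_forall hg)
  have h3 := h1.trans h2
  rw [eLpNorm_exponent_top] at h3
  -- For empty `K` the constant `c` may be negative, but then nothing is claimed.
  by_cases hK : Nonempty K
  · have hc : 0 ≤ c := (norm_nonneg _).trans (hg hK.some)
    filter_upwards [ae_le_eLpNormEssSup (f := T (ContinuousMap.toLp 1 μ ℂ g)) (μ := μ)] with y hy
    have h4 := hy.trans h3
    rw [← ofReal_norm] at h4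
    exact (ENNReal.ofReal_le_ofReal_iff hc).1 h4
  · exact .of_forall fun y => (hK ⟨y⟩).elim

theorem ae_eq_of_forall_integral_continuousMap {X : Type*} [TopologicalSpace X] [CompactSpace X]
    [T2Space X] [MeasurableSpace X] [BorelSpace X] {μ : Measure X} [IsFiniteMeasure μ] [μ.Regular]
    {F₁ F₂ : X → ℂ} (h₁ : MemLp F₁ 2 μ) (h₂ : MemLp F₂ 2 μ)
    (h : ∀ v : C(X, ℂ), ∫ x, v x * F₁ x ∂μ = ∫ x, v x * F₂ x ∂μ) : F₁ =ᵐ[μ] F₂ := by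
  have hi : ∀ {F : X → ℂ}, MemLp F 2 μ → ∀ v : C(X, ℂ), Integrable (fun x => v x * F x) μ := by
    intro F hF v
    simpa only [mul_comm] using
      integrable_mul_continuousMap (hF.integrable (by norm_num)) v
  have := ae_norm_le_of_forall_continuousMap (h₁.sub h₂) (memLp_const (0 : ℝ)) fun v => by
      simp only [Pi.sub_apply, mul_sub, integral_sub (hi h₁ v) (hi h₂ v), h v]
      simp
  filter_upwards [this] with x hx
  simpa [sub_eq_zero] using hx

variable {K : Type*} [TopologicalSpace K] [CompactSpace K] [T2Space K] [MeasurableSpace K]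
  [BorelSpace K] {μ : Measure K} [IsFiniteMeasure μ] [μ.Regular]

/-- A measure on `K × K` whose second marginal is dominated by `μ` represents an operator. -/
theorem exists_operator_of_marginal_le {ν : Measure (BorelProd K K)} [IsFiniteMeasure ν]
    (hν : ∀ v : C(K, ℂ), ∫ z, ‖v z.2‖ ∂ν ≤ ∫ y, ‖v y‖ ∂μ) :
    ∃ A : C(K, ℂ) →ₗ[ℂ] Lp ℂ 1 μ, (∀ u, ∀ᵐ y ∂μ, ‖A u y‖ ≤ ‖u‖) ∧
      ∀ u v : C(K, ℂ), ∫ z, u z.1 * v z.2 ∂ν = ∫ y, A u y * v y ∂μ := by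
  have hi : ∀ u v : C(K, ℂ), Integrable (fun z : BorelProd K K => u z.1 * v z.2) ν := fun u v =>
    ((tensor u v).memLp_of_isFiniteMeasure 1 ν).integrable le_rfl
  let φ : C(K, ℂ) → C(K, ℂ) →ₗ[ℂ] ℂ := fun u =>
    { toFun := fun v => ∫ z, u z.1 * v z.2 ∂ν
      map_add' := fun v w => by
        rw [← integral_add (hi u v) (hi u w)]
        simp [mul_add]
      map_smul' := fun c v => by
        rw [RingHom.id_apply, smul_eq_mul, ← integral_const_mul]
        simp [mul_left_comm] }
  have hφ : ∀ u v, ‖φ u v‖ ≤ ‖u‖ * ∫ y, ‖v y‖ ∂μ := fun u v => by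
    refine (norm_integral_le_integral_norm _).trans ?_
    refine le_trans ?_ (mul_le_mul_of_nonneg_left (hν v) (norm_nonneg u))
    rw [← integral_const_mul]
    have h1 := (hi 1 v).norm
    simp only [ContinuousMap.one_apply, one_mul] at h1
    refine integral_mono (hi u v).norm (h1.const_mul _) fun z => ?_
    simp only [norm_mul]
    exact mul_le_mul_of_nonneg_right (u.norm_coe_le_norm _) (norm_nonneg _)
  -- The densities are chosen separately for each u; uniqueness almost everywhere then makes them
  -- linear in u.
  choose F mF bF eF using fun u => exists_density_of_norm_le (φ u) (norm_nonneg u) (hφ u)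
  have lF : ∀ (p : ℝ≥0∞) u, MemLp (F u) p μ := fun p u => MemLp.of_bound (mF u) _ (bF u)
  have hiF : ∀ u v : C(K, ℂ), Integrable (fun y => v y * F u y) μ := fun u v => by
    simpa only [mul_comm] using
      integrable_mul_continuousMap ((lF 1 u).integrable le_rfl) v
  have hadd : ∀ u w, F (u + w) =ᵐ[μ] F u + F w := fun u w =>
    ae_eq_of_forall_integral_continuousMap (lF 2 _) ((lF 2 u).add (lF 2 w)) fun v => by
      simp only [Pi.add_apply, mul_add]
      rw [integral_add (hiF u v) (hiF w v), ← eF, ← eF, ← eF]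
      simp only [φ, LinearMap.coe_mk, AddHom.coe_mk]
      rw [← integral_add (hi u v) (hi w v)]
      simp [add_mul]
  have hsmul : ∀ (c : ℂ) u, F (c • u) =ᵐ[μ] c • F u := fun c u =>
    ae_eq_of_forall_integral_continuousMap (lF 2 _) ((lF 2 u).const_smul c) fun v => by
      simp only [Pi.smul_apply, smul_eq_mul, mul_left_comm _ c]
      rw [integral_const_mul, ← eF, ← eF]
      simp only [φ, LinearMap.coe_mk, AddHom.coe_mk]
      rw [← integral_const_mul]
      simp [mul_assoc]
  refine ⟨{ toFun := fun u => (lF 1 u).toLp (F u)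
            map_add' := fun u w => ?_
            map_smul' := fun c u => ?_ }, fun u => ?_, fun u v => ?_⟩
  · rw [← MemLp.toLp_add]
    exact MemLp.toLp_congr _ _ (hadd u w)
  · rw [RingHom.id_apply, ← MemLp.toLp_const_smul]
    exact MemLp.toLp_congr _ _ (hsmul c u)
  · filter_upwards [bF u, (lF 1 u).coeFn_toLp] with y hy h
    simpa [h] using hy
  · refine (eF u v).trans (integral_congr_ae ?_)
    filter_upwards [(lF 1 u).coeFn_toLp] with y h
    simp only [LinearMap.coe_mk, AddHom.coe_mk]
    rw [h, mul_comm]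

/-- Integrating `A f` against |v| gives the supremum of |Φ w| over |w| ≤ f ⊗ |v|. The choice w = g ⊗
v shows that `A f` bounds |S g|; conversely any bound of all |S g| bounds |Φ w| by the main
estimate, hence bounds `A f`. -/
theorem isLinearModulus_of_clm {S A : C(K, ℂ) →ₗ[ℂ] Lp ℂ 1 μ}
    (hS : ∀ (c : ℝ) (g : C(K, ℂ)), (∀ x, ‖g x‖ ≤ c) → ∀ᵐ y ∂μ, ‖S g y‖ ≤ c)
    {Φ : C(BorelProd K K, ℂ) →L[ℂ] ℂ} (hΦ : ∀ a b, Φ (tensor a b) = ∫ y, S a y * b y ∂μ)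
    {ν : Measure (BorelProd K K)} [IsFiniteMeasure ν]
    (hν : ∀ f : C(BorelProd K K, ℝ), 0 ≤ f → IsLUB (modulusSet Φ f) (∫ z, f z ∂ν))
    (hA : ∀ u, ∀ᵐ y ∂μ, ‖A u y‖ ≤ ‖u‖)
    (hAν : ∀ u v : C(K, ℂ), ∫ z, u z.1 * v z.2 ∂ν = ∫ y, A u y * v y ∂μ) :
    IsLinearModulus μ S A := by
  intro f hf
  set fc : C(K, ℂ) := f.complexify with hfc
  have hfn : ∀ x, ‖fc x‖ = f x := fun x => by
    have : 0 ≤ f x := hf x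
    simp [hfc, ContinuousMap.complexify, abs_of_nonneg this]
  have lA : MemLp (A fc) 2 μ := MemLp.of_bound (Lp.memLp _).1 _ (hA fc)
  let fv : C(K, ℂ) → C(BorelProd K K, ℝ) := fun v => ⟨fun z => f z.1 * ‖v z.2‖,
    (f.continuous.comp BorelProd.continuous_fst).mul
      (v.continuous.comp BorelProd.continuous_snd).norm⟩
  have hfv : ∀ v, 0 ≤ fv v := fun v z => mul_nonneg (hf _) (norm_nonneg _)
  let nv : C(K, ℂ) → C(K, ℝ) := fun v => ⟨fun y => ‖v y‖, by fun_prop⟩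
  have hnv : ∀ v, 0 ≤ nv v := fun v y => norm_nonneg _
  have hfvA : ∀ v, ((∫ z, fv v z ∂ν : ℝ) : ℂ) = ∫ y, A fc y * (nv v).complexify y ∂μ := fun v => by
    rw [← hAν, ← integral_complex_ofReal]
    refine integral_congr_ae (.of_forall fun z => ?_)
    simp [fv, nv, hfc, ContinuousMap.complexify]
  have hfvre : ∀ v, ∫ z, fv v z ∂ν = ∫ y, ‖v y‖ * (A fc y).re ∂μ := fun v => by
    have h1 := congrArg Complex.re (hfvA v)
    rw [Complex.ofReal_re] at h1
    rw [h1]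
    refine (integral_re (integrable_mul_continuousMap
      (lA.integrable (by norm_num)) _)).symm.trans ?_
    refine integral_congr_ae (.of_forall fun y => ?_)
    simp [nv, ContinuousMap.complexify, mul_comm]
  have hAle : ∀ v : C(K, ℂ), ‖∫ y, v y * A fc y ∂μ‖ ≤ ∫ z, fv v z ∂ν := fun v => by
    simp only [mul_comm (v _)]
    rw [← hAν]
    refine (norm_integral_le_integral_norm _).trans (le_of_eq ?_)
    refine integral_congr_ae (.of_forall fun z => ?_)
    simp [fv, hfn]
  -- Testing with complex v gives |A f| ≤ Re (A f), which forces `A f` to be real and nonnegative.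
  have hA0 : ∀ᵐ y ∂μ, A fc y = (absL1 μ (A fc) y : ℂ) := by
    have h1 : ∀ᵐ y ∂μ, ‖A fc y‖ ≤ (A fc y).re :=
      ae_norm_le_of_forall_continuousMap lA lA.re fun v => (hAle v).trans (hfvre v).le
    filter_upwards [h1, coeFn_absL1 (A fc)] with y hy h2
    rw [h2]
    exact Complex.eq_coe_norm_of_nonneg
      (Complex.re_eq_norm.1 (le_antisymm (Complex.re_le_norm _) hy))
  refine ⟨absL1 μ (A fc), ⟨?_, ?_⟩, hA0⟩
  · rintro _ ⟨g, hg, rfl⟩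
    rw [← Lp.coeFn_le]
    have hSg : MemLp (S g) 2 μ := MemLp.of_bound (Lp.memLp _).1 ‖g‖ (hS _ _ g.norm_coe_le_norm)
    have h1 : ∀ᵐ y ∂μ, ‖S g y‖ ≤ (A fc y).re := by
      refine ae_norm_le_of_forall_continuousMap hSg lA.re fun v => ?_
      simp only [mul_comm (v _)]
      rw [← hΦ]
      refine le_trans ?_ (hfvre v).le
      refine (hν (fv v) (hfv v)).1 ⟨tensor g v, fun z => ?_, rfl⟩
      rw [tensor_apply, norm_mul]
      exact mul_le_mul_of_nonneg_right (hg _) (norm_nonneg _)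
    filter_upwards [h1, coeFn_absL1 (A fc), coeFn_absL1 (S g)] with y hy h2 h3
    rw [h2, h3]
    exact hy.trans (Complex.re_le_norm _)
  · intro k hk
    -- Truncation at ‖f‖ keeps `k` an upper bound, by uniform contractivity of `S`, and makes it
    -- bounded, as the L² comparison requires.
    have hk' : ∀ g : C(K, ℂ), (∀ x, ‖g x‖ ≤ f x) → ∀ᵐ y ∂μ, ‖S g y‖ ≤ min (k y) ‖fc‖ := by
      intro g hg
      have h1 := (Lp.coeFn_le _ _).2 (hk ⟨g, hg, rfl⟩)
      have h2 := hS ‖fc‖ g fun x => (hg x).trans (by rw [← hfn]; exact fc.norm_coe_le_norm x)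
      filter_upwards [h1, h2, coeFn_absL1 (S g)] with y h3 h4 h5
      rw [h5] at h3
      exact le_min h3 h4
    have h0 : ∀ᵐ y ∂μ, 0 ≤ min (k y) ‖fc‖ := by
      filter_upwards [hk' 0 fun x => by simpa using hf x] with y hy
      exact (norm_nonneg _).trans hy
    have mk : AEStronglyMeasurable (fun y => min (k y) ‖fc‖) μ :=
      (Lp.memLp k).1.inf aestronglyMeasurable_const
    have bk : ∀ᵐ y ∂μ, ‖min (k y) ‖fc‖‖ ≤ ‖fc‖ := by
      filter_upwards [h0] with y hy
      rw [Real.norm_eq_abs, abs_of_nonneg hy]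
      exact min_le_right _ _
    have h1 : ∀ᵐ y ∂μ, ‖A fc y‖ ≤ min (k y) ‖fc‖ := by
      refine ae_norm_le_of_forall_continuousMap lA (MemLp.of_bound mk _ bk) fun v =>
        (hAle v).trans ((hν (fv v) (hfv v)).2 ?_)
      rintro _ ⟨w, hw, rfl⟩
      refine (norm_clm_le_of_norm_le S hΦ hf (hnv v) (Integrable.of_bound mk _ bk) h0 hk'
        hw).trans (le_of_eq ?_)
      exact integral_congr_ae (.of_forall fun y => mul_comm _ _)
    rw [← Lp.coeFn_le]
    filter_upwards [h1, coeFn_absL1 (A fc)] with y hy h2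
    rw [h2]
    exact hy.trans (min_le_left _ _)

theorem exists_representation {T : Lp ℂ 1 μ →ₗ[ℂ] Lp ℂ 1 μ} (hT : IsAbsoluteContraction μ T) :
    ∃ (A : C(K, ℂ) →ₗ[ℂ] Lp ℂ 1 μ) (ν : Measure (BorelProd K K))
        (m : ComplexMeasure (BorelProd K K)) (lam : BorelProd K K → ℂ),
      IsLinearModulus μ (onContinuous μ T) A ∧
      IsPositiveRepresentingMeasure μ A ν ∧
      IsComplexRepresentingMeasure μ (onContinuous μ T) m ∧
      IsUnimodularDensity ν m lam := by
  have hS : ∀ (c : ℝ) (g : C(K, ℂ)), (∀ x, ‖g x‖ ≤ c) →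
      ∀ᵐ y ∂μ, ‖onContinuous μ T g y‖ ≤ c := fun c g hg => ae_norm_onContinuous_le hT hg
  obtain ⟨Φ, hΦ⟩ := exists_clm_tensor (onContinuous μ T) (hS 1)
  obtain ⟨ν, lam, hfin, hreg, mlam, hlam, hint, hlub⟩ := exists_measure_unimodular_of_clm Φ
  -- This is the main estimate with f = 1 and k = 1.
  have hmarg : ∀ v : C(K, ℂ), ∫ z, ‖v z.2‖ ∂ν ≤ ∫ y, ‖v y‖ ∂μ := by
    intro v
    let V : C(BorelProd K K, ℝ) := ⟨fun z => ‖v z.2‖,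
      (v.continuous.comp BorelProd.continuous_snd).norm⟩
    refine (hlub V fun z => norm_nonneg _).2 ?_
    rintro _ ⟨w, hw, rfl⟩
    have := norm_clm_le_of_norm_le (onContinuous μ T) hΦ (f := 1)
      (v := ⟨fun y => ‖v y‖, by fun_prop⟩) (w := w) zero_le_one (fun y => norm_nonneg _)
      (integrable_const 1) (.of_forall fun _ => zero_le_one) (hS 1)
      (fun z => by
        rw [ContinuousMap.one_apply, one_mul]
        exact hw z)
    simpa using this
  obtain ⟨A, hA, hAν⟩ := exists_operator_of_marginal_le hmarg
  have hi : Integrable lam ν := Integrable.of_bound mlam 1 (hlam.mono fun z hz => hz.le)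
  refine ⟨A, ν, ν.withDensityᵥ lam, lam, isLinearModulus_of_clm hS hΦ hlub hA hAν, ⟨hreg, hAν⟩,
    ⟨?_, fun f g => ?_⟩, ⟨mlam, hlam, rfl⟩⟩
  · rwa [variation_withDensityᵥ_of_norm_eq_one hi hlam]
  · rw [← hΦ, hint]
    exact integral_withDensityᵥ_of_norm_eq_one hi hlam
      (((tensor f g).memLp_of_isFiniteMeasure 1 ν).integrable le_rfl)

end Existence

/-! ### Swap invariance of the representing measure -/

section Symmetry

/-- If the total variation of `F ν₁` is dominated by `ν₂`, with `F` unimodular, then `ν₁ ≤ ν₂`. -/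
theorem measure_le_of_forall_continuousMap {X : Type*} [TopologicalSpace X] [CompactSpace X]
    [T2Space X] [MeasurableSpace X] [BorelSpace X] {ν₁ ν₂ : Measure X} [IsFiniteMeasure ν₁]
    [IsFiniteMeasure ν₂] [ν₁.Regular] [ν₂.Regular] {F : X → ℂ} (mF : AEStronglyMeasurable F ν₁)
    (hF : ∀ᵐ x ∂ν₁, ‖F x‖ = 1)
    (h : ∀ v : C(X, ℂ), ‖∫ x, v x * F x ∂ν₁‖ ≤ ∫ x, ‖v x‖ ∂ν₂) : ν₁ ≤ ν₂ := by
  have hreg : (ν₁ + ν₂).Regular := inferInstance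
  have lF : MemLp F 2 ν₁ := MemLp.of_bound mF 1 (hF.mono fun x hx => hx.le)
  obtain ⟨u, mu, nu, uF⟩ :=
    exists_measurable_unimodular_mul mF.stronglyMeasurable_mk.measurable
  refine Measure.le_iff.2 fun E mE => ?_
  have bv : ∀ x, ‖E.indicator u x‖ = E.indicator (fun _ => (1 : ℝ)) x := fun x => by
    by_cases hx : x ∈ E <;> simp [hx, nu]
  have h1 := norm_integral_mul_le_of_forall_continuousMap (ρ := ν₁ + ν₂) (v := E.indicator u)
    (Measure.le_add_right le_rfl) (Measure.le_add_left le_rfl) lF (memLp_const (1 : ℝ))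
    (by simpa using h)
    (MemLp.of_bound (mu.indicator mE).aestronglyMeasurable 1 (.of_forall fun x => by
      rw [bv]
      by_cases hx : x ∈ E <;> simp [hx]))
  have h2 : ∫ x, E.indicator u x * F x ∂ν₁ =
      ((∫ x, E.indicator (fun _ => (1 : ℝ)) x ∂ν₁ : ℝ) : ℂ) := by
    rw [← integral_complex_ofReal]
    refine integral_congr_ae ?_
    filter_upwards [hF, mF.ae_eq_mk] with x hx hx'
    by_cases hxE : x ∈ E
    · simp only [Set.indicator_of_mem hxE]
      rw [hx', uF, ← hx', hx]
    · simp [hxE]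
  simp only [mul_one, bv] at h1
  rw [h2, Complex.norm_real, integral_indicator_const _ mE, integral_indicator_const _ mE] at h1
  simp only [smul_eq_mul, mul_one, Real.norm_eq_abs, abs_of_nonneg measureReal_nonneg] at h1
  exact (ENNReal.toReal_le_toReal (measure_ne_top _ _) (measure_ne_top _ _)).1 h1

/-- The coordinate swap. -/
def BorelProd.swap (K : Type*) [TopologicalSpace K] : BorelProd K K ≃ₜ BorelProd K K :=
  Homeomorph.prodComm K K

variable {K : Type*} [TopologicalSpace K]

@[simp]
theorem BorelProd.swap_fst (z : BorelProd K K) : (BorelProd.swap K z).1 = z.2 := rfl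

@[simp]
theorem BorelProd.swap_snd (z : BorelProd K K) : (BorelProd.swap K z).2 = z.1 := rfl

@[simp]
theorem BorelProd.swap_swap (z : BorelProd K K) :
    BorelProd.swap K (BorelProd.swap K z) = z := rfl

variable [CompactSpace K] [T2Space K] [MeasurableSpace K] [BorelSpace K] {μ : Measure K}
  [IsFiniteMeasure μ]

/-- λν and the conjugate of its swapped image agree on tensors, hence as functionals on C(K × K);
comparing variations and then densities gives both claims. -/
theorem symmetric_of_isSymmetricOperator {T : Lp ℂ 1 μ →ₗ[ℂ] Lp ℂ 1 μ}
    (hsymm : IsSymmetricOperator μ T) {ν : Measure (BorelProd K K)} [IsFiniteMeasure ν]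
    [ν.Regular] {lam : BorelProd K K → ℂ} (mlam : AEStronglyMeasurable lam ν)
    (hlam : ∀ᵐ z ∂ν, ‖lam z‖ = 1)
    (h : ∀ f g : C(K, ℂ), ∫ z, f z.1 * g z.2 * lam z ∂ν = ∫ x, onContinuous μ T f x * g x ∂μ) :
    MeasurePreserving (BorelProd.swap K) ν ν ∧
      ∀ᵐ z ∂ν, lam (BorelProd.swap K z) = conj (lam z) := by
  set σ := BorelProd.swap K with hσ
  have mσ : Measurable σ := σ.continuous.measurable
  have eσ : MeasurableEmbedding σ := σ.measurableEmbedding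
  have hi : Integrable lam ν := Integrable.of_bound mlam 1 (hlam.mono fun z hz => hz.le)
  set ν' := ν.map σ with hν'
  have hreg : ν'.Regular := Measure.Regular.map σ
  have hfin : IsFiniteMeasure ν' := inferInstance
  set lam' : BorelProd K K → ℂ := fun z => conj (lam (σ z)) with hlam'
  have hi' : Integrable lam' ν' := by
    rw [hν', eσ.integrable_map_iff]
    exact (LinearIsometryEquiv.integrable_comp_iff Complex.conjLIE).2 hi
  have hmap : ∀ w : BorelProd K K → ℂ,
      ∫ z, w z * lam' z ∂ν' = ∫ z, w (σ z) * conj (lam z) ∂ν := fun w => by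
    rw [hν', eσ.integral_map]
    rfl
  have hclm : integralMulCLM hi = integralMulCLM hi' := by
    refine clm_ext_of_tensor fun a b => ?_
    rw [integralMulCLM_apply, integralMulCLM_apply, hmap]
    have h1 := congrArg conj (h (star b) (star a))
    rw [← integral_conj, ← integral_conj] at h1
    have h2 : ∫ z, tensor a b (σ z) * conj (lam z) ∂ν =
        ∫ x, conj (onContinuous μ T (star b) x * (star a) x) ∂μ := by
      rw [← h1]
      refine integral_congr_ae (.of_forall fun z => ?_)
      simp [hσ, mul_comm (a z.2)]
    rw [h2]
    refine (h a b).trans ?_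
    have hbd : ∀ c : C(K, ℂ), MemLp (ContinuousMap.toLp 1 μ ℂ c : Lp ℂ 1 μ) ∞ μ := fun c =>
      (c.memLp_of_isFiniteMeasure ∞ μ).ae_eq (ContinuousMap.coeFn_toLp (𝕜 := ℂ) μ c).symm
    -- Symmetry is applied to the pair (b̄, a), since it is sesquilinear whereas the kernel identity
    -- is bilinear.
    have h3 := congrArg conj (hsymm _ _ (hbd (star b)) (hbd a))
    rw [← integral_conj, ← integral_conj] at h3
    refine Eq.trans ?_ (h3.symm.trans ?_)
    · refine integral_congr_ae ?_
      filter_upwards [ContinuousMap.coeFn_toLp (p := 1) (𝕜 := ℂ) μ (star b)] with x hx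
      rw [hx]
      simp [onContinuous, mul_comm]
    · refine integral_congr_ae ?_
      filter_upwards [ContinuousMap.coeFn_toLp (p := 1) (𝕜 := ℂ) μ a] with x hx
      rw [hx]
      simp [onContinuous]
  have hw : ∀ w : C(BorelProd K K, ℂ), ∫ z, w z * lam z ∂ν = ∫ z, w z * lam' z ∂ν' := fun w =>
    DFunLike.congr_fun hclm w
  have hlam'1 : ∀ᵐ z ∂ν', ‖lam' z‖ = 1 := by
    rw [hν', eσ.ae_map_iff]
    filter_upwards [hlam] with z hz
    simpa [hlam', hσ] using hz
  have hle : ν ≤ ν' := by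
    refine measure_le_of_forall_continuousMap mlam hlam fun v => ?_
    rw [hw]
    refine (norm_integral_le_integral_norm _).trans (le_of_eq (integral_congr_ae ?_))
    filter_upwards [hlam'1] with z hz
    rw [norm_mul, hz, mul_one]
  have hσσ : ν'.map σ = ν := by
    rw [hν', Measure.map_map mσ mσ]
    exact Measure.map_id
  -- The swap is an involution, so pushing forward one inequality gives the other.
  have hge : ν' ≤ ν := by
    have := Measure.map_mono hle mσ
    rwa [hσσ] at this
  have heq : ν' = ν := le_antisymm hge hle
  refine ⟨⟨mσ, heq⟩, ?_⟩
  have hae : lam =ᵐ[ν] lam' := by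
    refine ae_eq_of_forall_integral_continuousMap
      (MemLp.of_bound mlam 1 (hlam.mono fun z hz => hz.le)) ?_ fun v => ?_
    · rw [← heq]
      exact MemLp.of_bound hi'.1 1 (hlam'1.mono fun z hz => hz.le)
    · rw [hw, heq]
  filter_upwards [hae] with z hz
  rw [hz]
  simp [hlam']

end Symmetry

/-! ### Marginals and extension to conjugate exponents -/

section Disintegration

theorem BorelProd.measurable_fst {K : Type*} [TopologicalSpace K] [MeasurableSpace K] [BorelSpace K] :
    Measurable fun z : BorelProd K K => z.1 :=
  BorelProd.continuous_fst.measurable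

theorem BorelProd.measurable_snd {K : Type*} [TopologicalSpace K] [MeasurableSpace K] [BorelSpace K] :
    Measurable fun z : BorelProd K K => z.2 :=
  BorelProd.continuous_snd.measurable

variable {K : Type*} [TopologicalSpace K] [CompactSpace K] [MeasurableSpace K] [BorelSpace K]
  {μ : Measure K}

variable [IsFiniteMeasure μ]

/-- The constant 1 is an upper bound of all |T g| with |g| ≤ 1, so it dominates their supremum; the
member g = 0 makes that supremum nonnegative. -/
theorem ae_norm_modulus_one_le {T : Lp ℂ 1 μ →ₗ[ℂ] Lp ℂ 1 μ} (hT : IsAbsoluteContraction μ T)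
    {A : C(K, ℂ) →ₗ[ℂ] Lp ℂ 1 μ} (hA : IsLinearModulus μ (onContinuous μ T) A) :
    ∀ᵐ y ∂μ, ‖A 1 y‖ ≤ 1 := by
  obtain ⟨h, hlub, hh⟩ := hA 1 zero_le_one
  have h1 : ContinuousMap.mk (fun y => (((1 : C(K, ℝ)) y : ℝ) : ℂ)) (by fun_prop) =
      (1 : C(K, ℂ)) := by
    ext
    simp
  rw [h1] at hh
  have h0 : absL1 μ (onContinuous μ T 0) ≤ h := hlub.1 ⟨0, by simp, rfl⟩
  have h2 : h ≤ (memLp_const (1 : ℝ)).toLp (fun _ => (1 : ℝ)) := by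
    refine hlub.2 ?_
    rintro _ ⟨g, hg, rfl⟩
    rw [← Lp.coeFn_le]
    filter_upwards [coeFn_absL1 (onContinuous μ T g), ae_norm_onContinuous_le hT hg,
      (memLp_const (μ := μ) (p := 1) (1 : ℝ)).coeFn_toLp] with y h3 h4 h5
    rw [h3, h5]
    exact h4
  rw [← Lp.coeFn_le] at h0 h2
  filter_upwards [hh, h0, h2, (memLp_const (μ := μ) (p := 1) (1 : ℝ)).coeFn_toLp,
    coeFn_absL1 (onContinuous μ T 0)] with y h3 h4 h5 h6 h7
  rw [h6] at h5
  rw [h7] at h4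
  rw [h3, Complex.norm_real, Real.norm_eq_abs, abs_of_nonneg ((norm_nonneg _).trans h4)]
  exact h5

variable [T2Space K] [μ.Regular]

theorem map_snd_le {A : C(K, ℂ) →ₗ[ℂ] Lp ℂ 1 μ} (hA : ∀ᵐ y ∂μ, ‖A 1 y‖ ≤ 1)
    {ν : Measure (BorelProd K K)} [IsFiniteMeasure ν] (hν : IsPositiveRepresentingMeasure μ A ν) :
    ν.map (fun z => z.2) ≤ μ := by
  have := hν.regular
  -- The comparison of measures needs a regular marginal; inner regularity passes to it because
  -- compact sets have compact images.
  have hreg : (ν.map (fun z => z.2)).InnerRegularCompactLTTop :=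
    Measure.InnerRegularCompactLTTop.map_of_continuous BorelProd.continuous_snd
  refine measure_le_of_forall_continuousMap (F := fun _ => 1) aestronglyMeasurable_const (by simp)
    fun v => ?_
  have h1 := hν.integral_eq 1 v
  simp only [ContinuousMap.one_apply, one_mul] at h1
  simp only [mul_one]
  rw [integral_map BorelProd.measurable_snd.aemeasurable v.continuous.aestronglyMeasurable, h1]
  refine norm_integral_le_of_norm_le
    ((v.memLp_of_isFiniteMeasure 1 μ).integrable le_rfl).norm ?_
  filter_upwards [hA] with y hy
  rw [norm_mul]
  exact mul_le_of_le_one_left (norm_nonneg _) hy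

theorem integral_snd_eq {A : C(K, ℂ) →ₗ[ℂ] Lp ℂ 1 μ} (hA : ∀ᵐ y ∂μ, ‖A 1 y‖ ≤ 1)
    {ν : Measure (BorelProd K K)} [IsFiniteMeasure ν] (hν : IsPositiveRepresentingMeasure μ A ν)
    {F : K → ℂ} (hF : Integrable F μ) : ∫ z, F z.2 ∂ν = ∫ y, A 1 y * F y ∂μ := by
  have hle := map_snd_le hA hν
  have c₁ := continuous_integral_comp_mul (μ := μ) BorelProd.measurable_snd hle 1 (q := ∞)
    LipschitzWith.id rfl (memLp_const (μ := ν) (1 : ℂ))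
  have c₂ := continuous_integral_comp_mul (μ := μ) (ν := μ) (π := id) measurable_id (by simp) 1
    (q := ∞) LipschitzWith.id rfl (memLp_top_of_bound (Lp.memLp (A 1)).1 1 hA)
  simp only [id, mul_one] at c₁ c₂
  have key : ∀ F : Lp ℂ 1 μ, ∫ z, F (z : BorelProd K K).2 ∂ν = ∫ y, F y * A 1 y ∂μ := by
    refine fun F => (ContinuousMap.toLp_denseRange ℂ μ ℂ (p := 1) (by simp)).induction_on
      (p := fun F : Lp ℂ 1 μ => ∫ z, F (z : BorelProd K K).2 ∂ν = ∫ y, F y * A 1 y ∂μ) F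
      (isClosed_eq c₁ c₂) fun v => ?_
    have hv := ContinuousMap.coeFn_toLp (p := 1) (𝕜 := ℂ) μ v
    have h1 := hν.integral_eq 1 v
    simp only [ContinuousMap.one_apply, one_mul] at h1
    refine Eq.trans (integral_congr_ae ?_) (h1.trans (integral_congr_ae ?_))
    · filter_upwards [ae_comp_of_map_le BorelProd.measurable_snd hle hv] with z hz using hz
    · filter_upwards [hv] with y hy
      rw [hy, mul_comm]
  have hF' := (memLp_one_iff_integrable.2 hF).coeFn_toLp
  refine Eq.trans (integral_congr_ae ?_) ((key ((memLp_one_iff_integrable.2 hF).toLp F)).trans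
    (integral_congr_ae ?_))
  · filter_upwards [ae_comp_of_map_le BorelProd.measurable_snd hle hF'] with z hz using hz.symm
  · filter_upwards [hF'] with y hy
    rw [hy, mul_comm]

/-- Two L¹ density arguments, each with the other factor bounded: first in g, with f continuous so
that Tf is bounded, then in f, with g bounded. -/
theorem integral_operator_mul_of_bounded {T : Lp ℂ 1 μ →ₗ[ℂ] Lp ℂ 1 μ}
    (hT : IsAbsoluteContraction μ T) {ν : Measure (BorelProd K K)}
    (h₁ : ν.map (fun z => z.1) ≤ μ) (h₂ : ν.map (fun z => z.2) ≤ μ)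
    {lam : BorelProd K K → ℂ} (hlam : MemLp lam ∞ ν)
    (h : ∀ f g : C(K, ℂ), ∫ z, f z.1 * g z.2 * lam z ∂ν = ∫ x, onContinuous μ T f x * g x ∂μ)
    (f : Lp ℂ 1 μ) {g : K → ℂ} (hg : MemLp g ∞ μ) :
    ∫ z, f z.1 * g z.2 * lam z ∂ν = ∫ x, T f x * g x ∂μ := by
  have htop : ∀ {u : K → ℂ} {π : BorelProd K K → K}, Measurable π → ν.map π ≤ μ → MemLp u ∞ μ →
      MemLp (fun z => u (π z) * lam z) ∞ ν := fun hπ hle hu =>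
    hlam.mul (memLp_comp_of_map_le hπ hle hu)
  have hcont : ∀ (a : C(K, ℂ)) (g : Lp ℂ 1 μ),
      ∫ z, g z.2 * (a z.1 * lam z) ∂ν = ∫ x, g x * onContinuous μ T a x ∂μ := by
    intro a g
    have c₁ := continuous_integral_comp_mul (μ := μ) BorelProd.measurable_snd h₂ 1 (q := ∞)
      LipschitzWith.id rfl
      (htop BorelProd.measurable_fst h₁ (a.memLp_of_isFiniteMeasure ∞ μ))
    have c₂ := continuous_integral_comp_mul (μ := μ) (ν := μ) (π := id) measurable_id (by simp) 1
      (q := ∞) LipschitzWith.id rfl (memLp_top_of_bound (Lp.memLp (onContinuous μ T a)).1 ‖a‖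
        (ae_norm_onContinuous_le hT a.norm_coe_le_norm))
    simp only [id] at c₁ c₂
    refine (ContinuousMap.toLp_denseRange ℂ μ ℂ (p := 1) (by simp)).induction_on
      (p := fun g : Lp ℂ 1 μ =>
        ∫ z, g z.2 * (a z.1 * lam z) ∂ν = ∫ x, g x * onContinuous μ T a x ∂μ) g
      (isClosed_eq c₁ c₂) fun v => ?_
    have hv := ContinuousMap.coeFn_toLp (p := 1) (𝕜 := ℂ) μ v
    refine Eq.trans (integral_congr_ae ?_) ((h a v).trans (integral_congr_ae ?_))
    · filter_upwards [ae_comp_of_map_le BorelProd.measurable_snd h₂ hv] with z hz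
      rw [hz]
      ring
    · filter_upwards [hv] with y hy
      rw [hy, mul_comm]
  have hTc : Continuous T :=
    AddMonoidHomClass.continuous_of_bound T 1 fun f => by simpa using hT.norm_le f
  have c₁ := continuous_integral_comp_mul (μ := μ) BorelProd.measurable_fst h₁ 1 (q := ∞)
    LipschitzWith.id rfl (htop BorelProd.measurable_snd h₂ hg)
  have c₂ := (continuous_integral_comp_mul (μ := μ) (ν := μ) (π := id) measurable_id (by simp) 1
    (q := ∞) LipschitzWith.id rfl hg).comp hTc
  simp only [id, Function.comp_def] at c₁ c₂
  simp only [mul_assoc]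
  refine (ContinuousMap.toLp_denseRange ℂ μ ℂ (p := 1) (by simp)).induction_on
    (p := fun f : Lp ℂ 1 μ => ∫ z, f z.1 * (g z.2 * lam z) ∂ν = ∫ x, T f x * g x ∂μ) f
    (isClosed_eq c₁ c₂) fun a => ?_
  have ha := ContinuousMap.coeFn_toLp (p := 1) (𝕜 := ℂ) μ a
  have hg1 : MemLp g 1 μ := hg.mono_exponent le_top
  have hgae := hg1.coeFn_toLp
  refine Eq.trans (integral_congr_ae ?_) ((hcont a (hg1.toLp g)).trans (integral_congr_ae ?_))
  · filter_upwards [ae_comp_of_map_le BorelProd.measurable_fst h₁ ha,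
      ae_comp_of_map_le BorelProd.measurable_snd h₂ hgae] with z hz hz'
    rw [hz, hz']
    ring
  · filter_upwards [hgae] with y hy
    rw [hy, mul_comm]
    rfl

/-- The kernel representation of `T` extends to conjugate exponents. -/
theorem integral_operator_mul {T : Lp ℂ 1 μ →ₗ[ℂ] Lp ℂ 1 μ}
    (hT : IsAbsoluteContraction μ T) {ν : Measure (BorelProd K K)}
    (h₁ : ν.map (fun z => z.1) ≤ μ) (h₂ : ν.map (fun z => z.2) ≤ μ)
    {lam : BorelProd K K → ℂ} (mlam : AEStronglyMeasurable lam ν) (hlam : ∀ᵐ z ∂ν, ‖lam z‖ = 1)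
    (h : ∀ f g : C(K, ℂ), ∫ z, f z.1 * g z.2 * lam z ∂ν = ∫ x, onContinuous μ T f x * g x ∂μ)
    (f : Lp ℂ 1 μ) {g : K → ℂ} (mg : AEStronglyMeasurable g μ)
    (hfg : Integrable (fun z : BorelProd K K => f z.1 * g z.2) ν) :
    Integrable (fun x => T f x * g x) μ ∧
      ∫ z, f z.1 * g z.2 * lam z ∂ν = ∫ x, T f x * g x ∂μ := by
  have tlam : MemLp lam ∞ ν := memLp_top_of_bound mlam 1 (hlam.mono fun z hz => hz.le)
  have hbdd := fun {g : K → ℂ} (hg : MemLp g ∞ μ) =>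
    integral_operator_mul_of_bounded hT h₁ h₂ tlam h f hg
  set g' := mg.mk g with hg'
  have mg' : Measurable g' := mg.stronglyMeasurable_mk.measurable
  have hgg' := mg.ae_eq_mk
  have hgg'ν := ae_comp_of_map_le BorelProd.measurable_snd h₂ hgg'
  -- Truncating g at height n reduces to the bounded case. No L^p bound for `T` is used:
  -- integrability of Tf·g comes from that of f(x)g(y).
  set φ : ℕ → Set K := fun n => {y | ‖g' y‖ ≤ n} with hφ
  have mφ : ∀ n, MeasurableSet (φ n) := fun n => measurableSet_le mg'.norm measurable_const
  have hev : ∀ y, ∀ᶠ n in Filter.atTop, y ∈ φ n := fun y => by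
    obtain ⟨N, hN⟩ := exists_nat_ge ‖g' y‖
    filter_upwards [Filter.eventually_ge_atTop N] with n hn
    exact hN.trans (by exact_mod_cast hn)
  have cφ : AECover μ Filter.atTop φ := ⟨.of_forall hev, mφ⟩
  have cψ : AECover ν Filter.atTop fun n => (fun z : BorelProd K K => z.2) ⁻¹' φ n :=
    ⟨.of_forall fun z => hev z.2, fun n => BorelProd.measurable_snd (mφ n)⟩
  obtain ⟨u, mu, nu, uT⟩ := exists_measurable_unimodular_mul (Lp.stronglyMeasurable (T f)).measurable
  have bφ : ∀ n y, ‖(φ n).indicator g' y‖ ≤ n := fun n y => by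
    by_cases hy : y ∈ φ n
    · rw [Set.indicator_of_mem hy]
      exact hy
    · simp [hy]
  have tφ : ∀ n, MemLp ((φ n).indicator g') ∞ μ := fun n =>
    memLp_top_of_bound (mg'.indicator (mφ n)).aestronglyMeasurable n (.of_forall (bφ n))
  have tφu : ∀ n, MemLp (fun y => u y * (‖(φ n).indicator g' y‖ : ℂ)) ∞ μ := fun n =>
    memLp_top_of_bound (mu.mul (Complex.measurable_ofReal.comp
      (mg'.indicator (mφ n)).norm)).aestronglyMeasurable n (.of_forall fun y => by
        rw [norm_mul, nu, one_mul, Complex.norm_real, norm_norm]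
        exact bφ n y)
  have iφ : ∀ n, Integrable (fun x => T f x * (φ n).indicator g' x) μ := fun n =>
    (L1.integrable_coeFn (T f)).mul_of_top_left (tφ n)
  have hind : ∀ n x, T f x * (φ n).indicator g' x = (φ n).indicator (fun x => T f x * g' x) x := by
    intro n x
    by_cases hx : x ∈ φ n <;> simp [hx]
  -- The bounded case is applied to |g| truncated times the phase of Tf, which turns the right side
  -- into an integral of |Tf·g|; the bound does not depend on n.
  have key : ∀ n, ∫ x in φ n, ‖T f x * g' x‖ ∂μ ≤ ∫ z, ‖f z.1 * g z.2‖ ∂ν := by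
    intro n
    have e1 : ∫ x, T f x * (u x * (‖(φ n).indicator g' x‖ : ℂ)) ∂μ =
        ((∫ x in φ n, ‖T f x * g' x‖ ∂μ : ℝ) : ℂ) := by
      rw [← integral_indicator (mφ n), ← integral_complex_ofReal]
      refine integral_congr_ae (.of_forall fun x => ?_)
      simp only
      rw [← mul_assoc, mul_comm _ (u x), uT]
      by_cases hx : x ∈ φ n <;> simp [hx]
    have e2 := hbdd (tφu n)
    rw [e1] at e2
    have e3 := congrArg norm e2
    rw [Complex.norm_real, Real.norm_eq_abs] at e3
    refine (le_abs_self _).trans (e3.symm.le.trans ?_)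
    refine norm_integral_le_of_norm_le hfg.norm ?_
    filter_upwards [hlam, hgg'ν] with z hz hz'
    rw [norm_mul, hz, mul_one, norm_mul, norm_mul, norm_mul, nu, one_mul, Complex.norm_real,
      norm_norm, hz']
    refine mul_le_mul_of_nonneg_left ?_ (norm_nonneg _)
    exact norm_indicator_le_norm_self _ _
  have hInt' : Integrable (fun x => T f x * g' x) μ := by
    refine cφ.integrable_of_integral_norm_bounded _ (fun n => ?_) (.of_forall key)
    rw [← integrable_indicator_iff (mφ n)]
    exact (iφ n).congr (.of_forall (hind n))
  have hTgg' : (fun x => T f x * g' x) =ᵐ[μ] fun x => T f x * g x := by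
    filter_upwards [hgg'] with x hx
    rw [hx]
  refine ⟨hInt'.congr hTgg', ?_⟩
  rw [← integral_congr_ae hTgg']
  have hJ : Integrable (fun z : BorelProd K K => f z.1 * g z.2 * lam z) ν :=
    hfg.mul_of_top_left tlam
  have t₁ := cφ.integral_tendsto_of_countably_generated hInt'
  have t₂ := cψ.integral_tendsto_of_countably_generated hJ
  refine tendsto_nhds_unique t₂ (t₁.congr fun n => ?_)
  rw [← integral_indicator (mφ n), ← integral_indicator (BorelProd.measurable_snd (mφ n)),
    ← integral_congr_ae (.of_forall (hind n)), ← hbdd (tφ n)]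
  refine integral_congr_ae ?_
  filter_upwards [hgg'ν] with z hz
  by_cases hzφ : z.2 ∈ φ n
  · have : z ∈ (fun z : BorelProd K K => z.2) ⁻¹' φ n := hzφ
    rw [Set.indicator_of_mem this, Set.indicator_of_mem hzφ, hz]
  · have : z ∉ (fun z : BorelProd K K => z.2) ⁻¹' φ n := hzφ
    rw [Set.indicator_of_notMem this, Set.indicator_of_notMem hzφ]
    simp

theorem formZ2_eq (c a₀ a₁ b₀ b₁ : ℂ) :
    formZ2 c ![a₀, a₁] ![b₀, b₁] =
      2⁻¹ * (a₀ * b₀ - conj c * (a₁ * b₀) + a₁ * b₁ - c * (a₀ * b₁)) := by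
  have h : ∀ F : Fin 2 → ℂ, ∫ i, F i ∂zetaTwo = 2⁻¹ * (F 0 + F 1) := fun F => by
    rw [zetaTwo, integral_smul_measure, integral_count]
    simp [mul_add]
  rw [formZ2, h]
  simp [matrixE, Matrix.mulVec, dotProduct, Fin.sum_univ_two, Matrix.one_apply]
  ring

end Disintegration

/-! ### Assembling the disintegration formula -/

theorem theorem4p12 {K : Type*} [TopologicalSpace K] [CompactSpace K] [T2Space K]
    [MeasurableSpace K] [BorelSpace K] (μ : Measure K) [IsFiniteMeasure μ] [μ.Regular]
    (T : Lp ℂ 1 μ →ₗ[ℂ] Lp ℂ 1 μ)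
    (hT : IsAbsoluteContraction μ T) (hsymm : IsSymmetricOperator μ T) :
    -- the objects `A = |T|`, `ν = μ_{|T|}`, `m = μ_T` and `lam` exist
    (∃ (A : C(K, ℂ) →ₗ[ℂ] Lp ℂ 1 μ) (ν : Measure (BorelProd K K))
        (m : ComplexMeasure (BorelProd K K)) (lam : BorelProd K K → ℂ),
      IsLinearModulus μ (onContinuous μ T) A ∧
      IsPositiveRepresentingMeasure μ A ν ∧
      IsComplexRepresentingMeasure μ (onContinuous μ T) m ∧
      IsUnimodularDensity ν m lam) ∧
    -- and the disintegration formula holds for them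
    ∀ (A : C(K, ℂ) →ₗ[ℂ] Lp ℂ 1 μ) (ν : Measure (BorelProd K K))
        (m : ComplexMeasure (BorelProd K K)) (lam : BorelProd K K → ℂ),
      IsLinearModulus μ (onContinuous μ T) A →
      IsPositiveRepresentingMeasure μ A ν →
      IsComplexRepresentingMeasure μ (onContinuous μ T) m →
      IsUnimodularDensity ν m lam →
      ∀ (p q : ℝ≥0∞) (hp : 1 ≤ p), p⁻¹ + q⁻¹ = 1 →
        ∀ (f g : K → ℂ) (hf : MemLp f p μ), MemLp g q μ →
          Integrable (fun x => (f x - T ((hf.mono_exponent hp).toLp f) x) * g x) μ ∧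
          Integrable (fun x => (f x - A 1 x * f x) * g x) μ ∧
          Integrable (fun z : BorelProd K K =>
            formZ2 (lam z) ![f z.1, f z.2] ![g z.1, g z.2]) ν ∧
          ∫ x, (f x - T ((hf.mono_exponent hp).toLp f) x) * g x ∂μ =
            ∫ x, (f x - A 1 x * f x) * g x ∂μ +
            ∫ z : BorelProd K K, formZ2 (lam z) ![f z.1, f z.2] ![g z.1, g z.2] ∂ν := by

  refine ⟨exists_representation hT, ?_⟩
  intro A ν m lam hA hν hm hl p q hp hpq f g hf hg
  have hpq' : p.HolderConjugate q := ⟨by simpa using hpq⟩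
  have hνreg := hν.regular
  have hfin : IsFiniteMeasure ν := ⟨isCompact_univ.measure_lt_top⟩
  have mlam := hl.aestronglyMeasurable
  have hlam := hl.norm_eq_one
  have hi : Integrable lam ν := Integrable.of_bound mlam 1 (hlam.mono fun z hz => hz.le)
  have tlam : MemLp lam ∞ ν := memLp_top_of_bound mlam 1 (hlam.mono fun z hz => hz.le)
  have hker : ∀ f g : C(K, ℂ),
      ∫ z, f z.1 * g z.2 * lam z ∂ν = ∫ x, onContinuous μ T f x * g x ∂μ := fun f g => by
    rw [← hm.integral_eq, hl.eq_withDensity]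
    exact (integral_withDensityᵥ_of_norm_eq_one hi hlam
      (((tensor f g).memLp_of_isFiniteMeasure 1 ν).integrable le_rfl)).symm
  obtain ⟨hσ, hlamσ⟩ := symmetric_of_isSymmetricOperator hsymm mlam hlam hker
  have hσe : MeasurableEmbedding (BorelProd.swap K) := (BorelProd.swap K).measurableEmbedding
  have hA1 := ae_norm_modulus_one_le hT hA
  have h₂ := map_snd_le hA1 hν
  -- Swap invariance carries the bound on the second marginal to the first.
  have h₁ : ν.map (fun z => z.1) ≤ μ := by
    rw [← hσ.map_eq, Measure.map_map BorelProd.measurable_fst hσ.measurable]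
    exact h₂
  have f₁ := memLp_comp_of_map_le BorelProd.measurable_fst h₁ hf
  have f₂ := memLp_comp_of_map_le BorelProd.measurable_snd h₂ hf
  have g₁ := memLp_comp_of_map_le BorelProd.measurable_fst h₁ hg
  have g₂ := memLp_comp_of_map_le BorelProd.measurable_snd h₂ hg
  have hfg : Integrable (fun x => f x * g x) μ := hf.integrable_mul hg
  have i₁₁ : Integrable (fun z : BorelProd K K => f z.1 * g z.1) ν := f₁.integrable_mul g₁
  have i₁₂ : Integrable (fun z : BorelProd K K => f z.1 * g z.2) ν := f₁.integrable_mul g₂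
  have i₂₁ : Integrable (fun z : BorelProd K K => f z.2 * g z.1) ν := f₂.integrable_mul g₁
  have i₂₂ : Integrable (fun z : BorelProd K K => f z.2 * g z.2) ν := f₂.integrable_mul g₂
  set F := (hf.mono_exponent hp).toLp f with hF
  have hFf : F =ᵐ[μ] f := (hf.mono_exponent hp).coeFn_toLp
  have hFf₁ := ae_comp_of_map_le BorelProd.measurable_fst h₁ hFf
  obtain ⟨iT, eT⟩ := integral_operator_mul hT h₁ h₂ mlam hlam hker F hg.1
    (i₁₂.congr (by filter_upwards [hFf₁] with z hz; rw [hz]))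
  have eT' : ∫ z : BorelProd K K, lam z * (f z.1 * g z.2) ∂ν = ∫ x, T F x * g x ∂μ := by
    rw [← eT]
    refine integral_congr_ae ?_
    filter_upwards [hFf₁] with z hz
    rw [hz, mul_comm]
  -- The swap exchanges the two cross terms, since it conjugates λ.
  have eT'' : ∫ z : BorelProd K K, conj (lam z) * (f z.2 * g z.1) ∂ν = ∫ x, T F x * g x ∂μ := by
    rw [← eT', ← hσ.integral_comp hσe]
    refine integral_congr_ae ?_
    filter_upwards [hlamσ] with z hz
    rw [hz]
    simp
  have iA : Integrable (fun x => A 1 x * (f x * g x)) μ :=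
    hfg.bdd_mul (Lp.memLp (A 1)).1 hA1
  have e₂₂ : ∫ z : BorelProd K K, f z.2 * g z.2 ∂ν = ∫ x, A 1 x * (f x * g x) ∂μ :=
    integral_snd_eq hA1 hν hfg
  have e₁₁ : ∫ z : BorelProd K K, f z.1 * g z.1 ∂ν = ∫ x, A 1 x * (f x * g x) ∂μ := by
    rw [← e₂₂]
    exact hσ.integral_comp hσe fun z => f z.2 * g z.2
  have j₁₂ : Integrable (fun z : BorelProd K K => lam z * (f z.1 * g z.2)) ν :=
    i₁₂.bdd_mul mlam (hlam.mono fun z hz => hz.le)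
  have j₂₁ : Integrable (fun z : BorelProd K K => conj (lam z) * (f z.2 * g z.1)) ν :=
    i₂₁.bdd_mul (Complex.continuous_conj.comp_aestronglyMeasurable mlam)
      (hlam.mono fun z hz => by simpa using hz.le)
  have d₁ : Integrable (fun z : BorelProd K K =>
      f z.1 * g z.1 - conj (lam z) * (f z.2 * g z.1)) ν := i₁₁.sub j₂₁
  have d₂ : Integrable (fun z : BorelProd K K =>
      f z.1 * g z.1 - conj (lam z) * (f z.2 * g z.1) + f z.2 * g z.2) ν := d₁.add i₂₂
  simp only [formZ2_eq, sub_mul, mul_assoc]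
  refine ⟨hfg.sub iT, hfg.sub iA, (d₂.sub j₁₂).const_mul _, ?_⟩
  rw [integral_sub hfg iT, integral_sub hfg iA, integral_const_mul,
    integral_sub d₂ j₁₂, integral_add d₁ i₂₂,
    integral_sub i₁₁ j₂₁, e₁₁, e₂₂, eT', eT'']
  ring
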